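/- Let $a\in\mathbb{R}\cup\{-\infty\}$ and let $\varphi:\,]a,+\infty[\,\to\mathbb{R}$ be a smooth function with $\dot\varphi>0$ and $\ddot\varphi\ge 0$. Suppose that for all sufficiently large $z$ $$\dot\varphi(z)=\Lambda z+\beta+\sum_{n=1}^{\infty}\frac{a_n}{z^n},\qquad a_n\in\mathbb{R},$$ where either $\Lambda>0$ and the first non-vanishing $a_k$ (if any) is positive, or $\Lambda=0$, $\beta>0$ and the first non-vanishing $a_k$ (if any) is negative. Let $u=u(r)$, $r=\sqrt{x^2+y^2}$, be a rotationally symmetric $[\varphi,\vec e_3]$-minimal graph, that is, a $C^2$ rotationally symmetric solution, with values in $]a,+\infty[$, of $$(1+u_x^2)u_{yy}+(1+u_y^2)u_{xx}-2u_xu_yu_{xy}=\dot\varphi(u)\,(1+u_x^2+u_y^2)$$ on an annulus $\{R<r<\rho\}$ or a disc $\{r<\rho\}$, $\rho\in\,]0,+\infty]$, which cannot be extended, as such a solution, to a larger outer radius. Assume that $u$ is not strictly decreasing as a function of $r$ (as is the case for bowls and for the wings of catenoids). Then $\rho=+\infty$, and as $r\to+\infty$: 1. if $\Lambda>0$, there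 is a constant $C>0$ such that $$\varphi(u(r))=C\,e^{\Lambda r^2}+O(r^2);$$ 2. if $\Lambda=0$, then for every $u_0\in\,]a,+\infty[$, with $\mathcal{G}(z)=\int_{u_0}^{z}\frac{d\xi}{\dot\varphi(\xi)}$, there is a constant $c\in\mathbb{R}$ such that $$\mathcal{G}(u(r))=\frac{r^2}{2}-\frac{1}{\beta^2}\log r+c+O(r^{-2}).$$ -/

import Mathlib

open Filter Asymptotics
open scoped ContDiff

noncomputable section

namespace PhiMinimal

/-- The interval `]a, +∞[` of heights, where `a` is a real number or `-∞`. -/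
def heights (a : EReal) : Set ℝ := {z | a < (z : EReal)}

/-- The first partial derivative `v_x`. -/
def partialX (v : ℝ × ℝ → ℝ) (p : ℝ × ℝ) : ℝ := deriv (fun t => v (t, p.2)) p.1

/-- The first partial derivative `v_y`. -/
def partialY (v : ℝ × ℝ → ℝ) (p : ℝ × ℝ) : ℝ := deriv (fun t => v (p.1, t)) p.2

/-- `v` is a (classical) `[φ, e₃]`-minimal function on the open set `Ω`: it is of class `C²`,
its graph lies in `ℝ² × ]a, +∞[`, and
`(1 + v_x²) v_yy + (1 + v_y²) v_xx - 2 v_x v_y v_xy = φ̇(v) W²` with `W² = 1 + v_x² + v_y²`. -/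
structure IsMinimalGraph (φ : ℝ → ℝ) (a : EReal) (Ω : Set (ℝ × ℝ)) (v : ℝ × ℝ → ℝ) : Prop where
  contDiffOn : ContDiffOn ℝ 2 v Ω
  mem_heights : ∀ p ∈ Ω, v p ∈ heights a
  equation : ∀ p ∈ Ω,
    (1 + partialX v p ^ 2) * partialY (partialY v) p
      + (1 + partialY v p ^ 2) * partialX (partialX v) p
      - 2 * partialY v p * partialX v p * partialY (partialX v) p
      = deriv φ (v p) * (1 + partialX v p ^ 2 + partialY v p ^ 2)

/-- The Euclidean distance of a point of the plane to the origin. -/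
def radius (p : ℝ × ℝ) : ℝ := Real.sqrt (p.1 ^ 2 + p.2 ^ 2)

/-- The radii `r ≥ 0` with `R < r < ρ`. -/
def radii (R : ℝ) (ρ : EReal) : Set ℝ := {r | 0 ≤ r ∧ R < r ∧ (r : EReal) < ρ}

/-- The plane domain `{R < |p| < ρ}`: an annulus (a punctured disc if `R = 0`), a disc if `R < 0`;
it is unbounded if `ρ = ⊤`. -/
def annulus (R : ℝ) (ρ : EReal) : Set (ℝ × ℝ) := {p | radius p ∈ radii R ρ}

/-- The rotationally symmetric function `p ↦ u(|p|)` with profile `u` is `[φ, e₃]`-minimal on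
`{R < |p| < ρ}`. -/
def IsRotational (φ : ℝ → ℝ) (a : EReal) (R : ℝ) (ρ : EReal) (u : ℝ → ℝ) : Prop :=
  IsMinimalGraph φ a (annulus R ρ) (fun p => u (radius p))

/-- A rotational `[φ, e₃]`-minimal graph on `{R < |p| < ρ}` that does not extend to a rotational
`[φ, e₃]`-minimal graph on `{R < |p| < ρ'}` for any `ρ' > ρ`. -/
def IsMaximalRotational (φ : ℝ → ℝ) (a : EReal) (R : ℝ) (ρ : EReal) (u : ℝ → ℝ) : Prop :=
  IsRotational φ a R ρ u ∧
    ¬ ∃ (ρ' : EReal) (v : ℝ → ℝ), ρ < ρ' ∧ IsRotational φ a R ρ' v ∧ Set.EqOn v u (radii R ρ)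

/-- For all large `z`, `f z = Λ z + β + ∑_{n ≥ 1} aₙ / zⁿ` with a convergent series, where either
`Λ > 0` and the first non-vanishing `aₖ` (if there is one) is positive, or `Λ = 0`, `β > 0` and
the first non-vanishing `aₖ` (if there is one) is negative. -/
def HasExpansionAtTop (f : ℝ → ℝ) (Λ β : ℝ) : Prop :=
  ∃ c : ℕ → ℝ,
    (∀ᶠ z : ℝ in atTop,
      HasSum (fun n : ℕ => c (n + 1) / z ^ (n + 1)) (f z - (Λ * z + β))) ∧
    ((0 < Λ ∧ ∀ k, 1 ≤ k → (∀ j, 1 ≤ j → j < k → c j = 0) → c k ≠ 0 → 0 < c k) ∨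
      (Λ = 0 ∧ 0 < β ∧ ∀ k, 1 ≤ k → (∀ j, 1 ≤ j → j < k → c j = 0) → c k ≠ 0 → c k < 0))

end PhiMinimal

end

noncomputable section

namespace PhiMinimal

open Topology

/-! For a radial graph the equation becomes `w' = (1 + w²)(φ̇(u) - w/r)` with `w = u'`. At a zero of
`w` one has `w' = φ̇(u) > 0`, so once nonnegative the slope stays nonnegative; a graph that is not
strictly decreasing has such a radius. From there on `φ̇(u)` is nondecreasing and `w` is at most a
constant plus `r φ̇(u)`. As `φ̇` grows at most linearly, Gronwall's inequality excludes blow-up at a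
finite radius: `u` and `w` have limits there, the equation can be restarted, and maximality forces
`ρ = ⊤` (`IsProfile.exists_extension`).

For large `r` put `F = φ̇(u)`, `F₁ = φ̈(u)`. The factor `1 + w²` drives `w` towards `r F`: the
defect `h = F - w/r` satisfies `h' = F₁ w + w/r² - (1 + w²) h/r`, with a damping term that
dominates. Barrier arguments give `h ≥ 0`, a bound on `h F` used when `Λ > 0`
(`IsSlope.exists_defect_mul_force_le`), and a bound on `r² h` used when `Λ = 0`
(`IsSlope.exists_sq_mul_defect_le`).

If `Λ > 0`, then `(φ∘u)' = F w = r F² - r h F`, and `F² = 2Λφ(u) + O(log u)` with `log u = O(r²)`.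
So `φ∘u` solves `Φ' = 2Λ r Φ + O(r³)`, which is integrated in `exists_isBigO_exp`.

If `Λ = 0`, then `𝒢(u)' = w/F = r - r h/F`. The equation for `w` replaces `r h/F` by `1/(F w)`, up
to the exact derivative of `r/(F w)` and terms `O(r⁻³)`; since `F` and `w/r` tend to `β`, this
produces the logarithm (`IsSlope.exists_isBigO_log`). -/

/-! ### Barriers and limits at infinity -/

/-- Since `c / r` has divergent integral, `d` cannot stay positive; after reaching a value `≤ 0` it
cannot cross zero upwards, its derivative being negative there. All barrier arguments at infinity
below are instances of this. -/
lemma eventually_nonpos_of_deriv_le {d d' : ℝ → ℝ} {c : ℝ} (hc : 0 < c)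
    (hd : ∀ᶠ r in atTop, HasDerivAt d (d' r) r)
    (hneg : ∀ᶠ r in atTop, 0 ≤ d r → d' r ≤ -(c / r)) : ∀ᶠ r in atTop, d r ≤ 0 := by
  obtain ⟨r₁, h₁⟩ := eventually_atTop.1 (hd.and (hneg.and (eventually_gt_atTop 0)))
  obtain ⟨r₂, hr₂, hd₂⟩ : ∃ r₂ ≥ r₁, d r₂ ≤ 0 := by
    by_contra! hcon
    have hanti : AntitoneOn (fun r => d r + c * Real.log r) (Set.Ici r₁) := by
      refine antitoneOn_of_hasDerivWithinAt_nonpos (f' := fun r => d' r + c * r⁻¹)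
        (convex_Ici _) ?_ ?_ ?_
      · intro r hr
        exact (((h₁ r hr).1.add ((Real.hasDerivAt_log (h₁ r hr).2.2.ne').const_mul c)
          ).continuousAt).continuousWithinAt
      · intro r hr
        rw [interior_Ici] at hr
        exact ((h₁ r hr.le).1.add ((Real.hasDerivAt_log (h₁ r hr.le).2.2.ne').const_mul c)
          ).hasDerivWithinAt
      · intro r hr
        rw [interior_Ici] at hr
        have := (h₁ r hr.le).2.1 (hcon r hr.le).le
        rw [div_eq_mul_inv] at this
        linarith
    obtain ⟨r, hr, hr'⟩ := ((Real.tendsto_log_atTop.const_mul_atTop hc).eventually_gt_atTop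
      (d r₁ + c * Real.log r₁) |>.and (eventually_ge_atTop r₁)).exists
    have h2 := hanti (Set.self_mem_Ici) hr' hr'
    have h3 := hcon r hr'
    simp only at h2
    linarith
  filter_upwards [eventually_ge_atTop r₂] with r hr
  have key := image_le_of_deriv_right_lt_deriv_boundary' (f := d) (f' := d') (a := r₂) (b := r)
    (B := fun _ => 0) (B' := fun _ => 0)
    (fun x hx => (h₁ x (hr₂.trans hx.1)).1.continuousAt.continuousWithinAt)
    (fun x hx => (h₁ x (hr₂.trans hx.1)).1.hasDerivWithinAt) hd₂ continuousOn_const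
    (fun x _ => hasDerivWithinAt_const _ _ _)
    (fun x hx h0 => by
      have h3 := h₁ x (hr₂.trans hx.1)
      have h4 := h3.2.1 h0.ge
      have : 0 < c / x := div_pos hc h3.2.2
      linarith)
  exact key ⟨hr, le_rfl⟩

/-- `f - E` increases and `f + E` decreases, so they squeeze a common limit `C`; here `E` plays the
role of the tail integral of a bound for `|f'|`. -/
lemma exists_limit_of_abs_deriv_le {f f' E E' : ℝ → ℝ}
    (hf : ∀ᶠ r in atTop, HasDerivAt f (f' r) r) (hE : ∀ᶠ r in atTop, HasDerivAt E (E' r) r)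
    (hle : ∀ᶠ r in atTop, |f' r| ≤ -E' r) (hlim : Tendsto E atTop (𝓝 0)) :
    ∃ C, ∀ᶠ r in atTop, |f r - C| ≤ E r := by
  obtain ⟨r₁, h₁⟩ := eventually_atTop.1 (hf.and (hE.and hle))
  have hmono : MonotoneOn (fun r => f r - E r) (Set.Ici r₁) := by
    refine monotoneOn_of_hasDerivWithinAt_nonneg (f' := fun r => f' r - E' r)
        (convex_Ici _) ?_ ?_ ?_
    · intro r hr
      exact ((h₁ r hr).1.sub (h₁ r hr).2.1).continuousAt.continuousWithinAt
    · intro r hr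
      rw [interior_Ici] at hr
      exact ((h₁ r hr.le).1.sub (h₁ r hr.le).2.1).hasDerivWithinAt
    · intro r hr
      rw [interior_Ici] at hr
      have := abs_le.1 (h₁ r hr.le).2.2
      linarith
  have hanti : AntitoneOn (fun r => f r + E r) (Set.Ici r₁) := by
    refine antitoneOn_of_hasDerivWithinAt_nonpos (f' := fun r => f' r + E' r)
        (convex_Ici _) ?_ ?_ ?_
    · intro r hr
      exact ((h₁ r hr).1.add (h₁ r hr).2.1).continuousAt.continuousWithinAt
    · intro r hr
      rw [interior_Ici] at hr
      exact ((h₁ r hr.le).1.add (h₁ r hr.le).2.1).hasDerivWithinAt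
    · intro r hr
      rw [interior_Ici] at hr
      have := abs_le.1 (h₁ r hr.le).2.2
      linarith
  have hEnonneg : ∀ r ∈ Set.Ici r₁, 0 ≤ E r := by
    intro r hr
    refine le_of_tendsto hlim ?_
    filter_upwards [eventually_ge_atTop r] with s hs
    have h1 := hmono hr (le_trans hr hs : r₁ ≤ s) hs
    have h2 := hanti hr (le_trans hr hs : r₁ ≤ s) hs
    simp only at h1 h2
    linarith
  have hcross : ∀ r ∈ Set.Ici r₁, ∀ s ∈ Set.Ici r₁, f r - E r ≤ f s + E s := by
    intro r hr s hs
    have h1 := hmono hr (le_trans hr (le_max_left r s) : r₁ ≤ _) (le_max_left r s)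
    have h2 := hanti hs (le_trans hs (le_max_right r s) : r₁ ≤ _) (le_max_right r s)
    have h3 := hEnonneg _ (le_trans hr (le_max_left r s) : r₁ ≤ _)
    simp only at h1 h2
    linarith
  refine ⟨sSup ((fun r => f r - E r) '' Set.Ici r₁), ?_⟩
  filter_upwards [eventually_ge_atTop r₁] with r hr
  have hb : BddAbove ((fun r => f r - E r) '' Set.Ici r₁) := by
    refine ⟨f r₁ + E r₁, ?_⟩
    rintro _ ⟨s, hs, rfl⟩
    exact hcross s hs r₁ Set.self_mem_Ici
  have h1 := le_csSup hb ⟨r, hr, rfl⟩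
  have h2 : sSup ((fun r => f r - E r) '' Set.Ici r₁) ≤ f r + E r := by
    refine csSup_le ⟨_, r, hr, rfl⟩ ?_
    rintro _ ⟨s, hs, rfl⟩
    exact hcross s hs r hr
  simp only at h1
  rw [abs_le]
  constructor <;> linarith

/-! ### The slope equation for large radii -/

/-- A solution, defined for large `r`, of `w' = (1 + w²) (F - w / r)` with `w ≥ 0`, along which
`F` is bounded below by a positive constant and has derivative `F₁ w` with `F₁ ≥ 0`. -/
structure IsSlope (F F₁ w : ℝ → ℝ) : Prop where
  deriv_slope : ∀ᶠ r in atTop, HasDerivAt w ((1 + w r ^ 2) * (F r - w r / r)) r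
  deriv_force : ∀ᶠ r in atTop, HasDerivAt F (F₁ r * w r) r
  nonneg : ∀ᶠ r in atTop, 0 ≤ w r
  deriv_nonneg : ∀ᶠ r in atTop, 0 ≤ F₁ r
  force_ge : ∃ c > 0, ∀ᶠ r in atTop, c ≤ F r

namespace IsSlope

variable {F F₁ w : ℝ → ℝ} (H : IsSlope F F₁ w)
include H

/-- Where `w ≤ c r / 4` the defect is at least `3c/4`, so `w` grows faster than the barrier `c r /
4`. -/
lemma exists_mul_le : ∃ ε > 0, ∀ᶠ r in atTop, ε * r ≤ w r := by
  obtain ⟨c, hc, hF⟩ := H.force_ge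
  refine ⟨c / 4, by positivity, ?_⟩
  have := eventually_nonpos_of_deriv_le (d := fun r => c / 4 * r - w r)
    (d' := fun r => c / 4 * 1 - (1 + w r ^ 2) * (F r - w r / r)) (c := c / 4) (by positivity)
    (by
      filter_upwards [H.deriv_slope] with r h
      exact ((hasDerivAt_id r).const_mul (c / 4)).sub h)
    (by
      filter_upwards [hF, eventually_ge_atTop 1] with r hF hr hd
      have h1 : w r / r ≤ c / 4 := by
        rw [div_le_iff₀ (by linarith)]; linarith
      have h2 : c / 4 / r ≤ c / 4 := div_le_self (by positivity) hr
      have h3 : c * 3 / 4 ≤ (1 + w r ^ 2) * (F r - w r / r) := by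
        nlinarith [sq_nonneg (w r)]
      linarith)
  filter_upwards [this] with r hr
  linarith

lemma deriv_defect : ∀ᶠ r in atTop, HasDerivAt (fun r => F r - w r / r)
    (F₁ r * w r + w r / r ^ 2 - (1 + w r ^ 2) * (F r - w r / r) / r) r := by
  filter_upwards [H.deriv_slope, H.deriv_force, eventually_gt_atTop 0] with r h1 h2 hr
  refine (h2.sub (h1.div (hasDerivAt_id r) hr.ne')).congr_deriv ?_
  simp only [id]
  field_simp
  ring

/-- Where the defect is `≤ 0`, one has `w / r ≥ F ≥ c`, and its derivative is at least `w / r² ≥ c /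
r`. -/
lemma defect_nonneg : ∀ᶠ r in atTop, 0 ≤ F r - w r / r := by
  obtain ⟨c, hc, hF⟩ := H.force_ge
  have := eventually_nonpos_of_deriv_le (c := c) hc (H.deriv_defect.mono fun r h => h.neg) (by
    filter_upwards [hF, H.nonneg, H.deriv_nonneg, eventually_gt_atTop 0] with r hF hw hF₁ hr hd
    have h0 : F r - w r / r ≤ 0 := by simpa using hd
    have h1 : c ≤ w r / r := by linarith
    have h2 : c / r ≤ w r / r ^ 2 := by
      have : w r / r ^ 2 = w r / r / r := by rw [sq, div_div]
      rw [this]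
      exact div_le_div_of_nonneg_right h1 hr.le
    have h3 : 0 ≤ F₁ r * w r := mul_nonneg hF₁ hw
    have h4 : (1 + w r ^ 2) * (F r - w r / r) / r ≤ 0 :=
      div_nonpos_of_nonpos_of_nonneg (mul_nonpos_of_nonneg_of_nonpos (by positivity) h0) hr.le
    linarith)
  filter_upwards [this] with r hr
  simpa using hr

/-- Where `w ≤ r F / 2`, the slope grows at rate at least `(1 + w²) F / 2`. The barrier `r F / 2`
grows at rate `F/2 + r F₁ w / 2`, and `F₁ ≤ (ε/2) F` with `ε r ≤ w` makes its second term at most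
`w² F / 4`. -/
lemma half_force_le (hsmall : ∀ ε > 0, ∀ᶠ r in atTop, F₁ r ≤ ε * F r) :
    ∀ᶠ r in atTop, r * F r / 2 ≤ w r := by
  obtain ⟨c, hc, hF⟩ := H.force_ge
  obtain ⟨ε, hε, hw⟩ := H.exists_mul_le
  have := eventually_nonpos_of_deriv_le (d := fun r => r * F r / 2 - w r)
    (d' := fun r => (1 * F r + r * (F₁ r * w r)) / 2 - (1 + w r ^ 2) * (F r - w r / r))
    (c := ε * ε * c / 4) (by positivity)
    (by
      filter_upwards [H.deriv_slope, H.deriv_force] with r h1 h2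
      exact (((hasDerivAt_id r).mul h2).div_const 2).sub h1)
    (by
      filter_upwards [hF, hw, hsmall (ε / 2) (by positivity), eventually_ge_atTop 1]
        with r hF hw hF₁ hr hd
      have hr0 : 0 < r := by linarith
      have hw0 : 0 ≤ w r := (by positivity : 0 ≤ ε * r).trans hw
      have h1 : w r / r ≤ F r / 2 := by
        rw [div_le_iff₀ hr0]; linarith
      have h3 : (1 + w r ^ 2) * (F r / 2) ≤ (1 + w r ^ 2) * (F r - w r / r) :=
        mul_le_mul_of_nonneg_left (by linarith) (by positivity)
      have h4 : r * (F₁ r * w r) ≤ r * (ε / 2 * F r * w r) := by gcongr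
      have h5 : ε * r * (w r * F r) ≤ w r * (w r * F r) :=
        mul_le_mul_of_nonneg_right hw (mul_nonneg hw0 (by linarith))
      have h6 : ε * ε * c ≤ ε * r * (w r * F r) := by
        have : ε * ε * c = ε * 1 * (ε * 1 * c) := by ring
        rw [this]
        have : ε * 1 ≤ w r := le_trans (by gcongr) hw
        gcongr
      have h7 : ε * ε * c / 4 / r ≤ ε * ε * c / 4 := div_le_self (by positivity) hr
      nlinarith)
  filter_upwards [this] with r hr
  linarith

/-- With `w / r ≥ F / 2` the damping of `h` is at least `w F h / 2`, and `h ≤ F`; hence `(h F)' ≤ w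
F (2 M + 1 - h F / 2)`, which is negative once `h F` is large. -/
lemma exists_defect_mul_force_le (hsmall : ∀ ε > 0, ∀ᶠ r in atTop, F₁ r ≤ ε * F r) {M : ℝ}
    (hM : ∀ᶠ r in atTop, F₁ r ≤ M) :
    ∃ K, ∀ᶠ r in atTop, (F r - w r / r) * F r ≤ K := by
  obtain ⟨c, hc, hF⟩ := H.force_ge
  obtain ⟨ε, hε, hw⟩ := H.exists_mul_le
  refine ⟨4 * (M + 1) + 2, ?_⟩
  have := eventually_nonpos_of_deriv_le
    (d := fun r => (F r - w r / r) * F r - (4 * (M + 1) + 2))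
    (d' := fun r => (F₁ r * w r + w r / r ^ 2 - (1 + w r ^ 2) * (F r - w r / r) / r) * F r
      + (F r - w r / r) * (F₁ r * w r))
    (c := ε * c) (by positivity)
    (by
      filter_upwards [H.deriv_defect, H.deriv_force] with r h1 h2
      exact (h1.mul h2).sub_const _)
    (by
      filter_upwards [hF, hw, hM, H.half_force_le hsmall, H.defect_nonneg, H.deriv_nonneg,
        eventually_ge_atTop 1] with r hF hw hM hhalf hh hF₁ hr hd
      have hr0 : 0 < r := by linarith
      have hw0 : 0 ≤ w r := (by positivity : 0 ≤ ε * r).trans hw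
      have hF0 : 0 < F r := by linarith
      have hwr : 0 ≤ w r / r := by positivity
      set h := F r - w r / r with hdef
      have h1 : w r / r ^ 2 ≤ w r := div_le_self hw0 (by nlinarith)
      have h2 : F r / 2 ≤ w r / r := by rw [le_div_iff₀ hr0]; linarith
      have h3 : w r * (F r / 2) * h ≤ (1 + w r ^ 2) * h / r := by
        have : (1 + w r ^ 2) * h / r = h / r + w r * (w r / r) * h := by field_simp
        rw [this]
        have h4 : 0 ≤ h / r := by positivity
        have h5 : w r * (F r / 2) * h ≤ w r * (w r / r) * h := by gcongr
        linarith
      have h6 : h * (F₁ r * w r) ≤ F r * (M * w r) := by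
        have : h ≤ F r := by linarith
        gcongr
      have h7 : (F₁ r * w r + w r / r ^ 2 - (1 + w r ^ 2) * h / r) * F r
          ≤ (M * w r + w r - w r * (F r / 2) * h) * F r := by
        gcongr
      have h8 : w r * F r * (4 * (M + 1) + 2) ≤ w r * F r * (h * F r) :=
        mul_le_mul_of_nonneg_left (by linarith) (by positivity)
      have h9 : ε * c / r ≤ ε * c := div_le_self (by positivity) hr
      have h10 : ε * c ≤ w r * F r := by
        have : ε ≤ w r := le_trans (le_mul_of_one_le_right hε.le hr) hw
        gcongr
      have h11 : 0 ≤ w r * F r := by positivity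
      nlinarith)
  filter_upwards [this] with r hr
  linarith

lemma exists_sq_mul_defect_le {M : ℝ} (hM : ∀ᶠ r in atTop, r ^ 2 * F₁ r ≤ M) :
    ∃ K, ∀ᶠ r in atTop, r ^ 2 * (F r - w r / r) ≤ K := by
  obtain ⟨ε, hε, hw⟩ := H.exists_mul_le
  -- Above this level the damping `w² r h ≥ ε w r² h` is at least `2 (M + 2) w`: one half beats the
  -- source `(M + 1) w` by at least `w`, the other half absorbs `2 r h`.
  refine ⟨2 * (M + 2) / ε, ?_⟩
  have := eventually_nonpos_of_deriv_le
    (d := fun r => r ^ 2 * (F r - w r / r) - 2 * (M + 2) / ε)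
    (d' := fun r => (2 * r) * (F r - w r / r) + r ^ 2 *
      (F₁ r * w r + w r / r ^ 2 - (1 + w r ^ 2) * (F r - w r / r) / r))
    (c := ε) hε
    (by
      filter_upwards [H.deriv_defect] with r h1
      have := ((hasDerivAt_pow 2 r).mul h1).sub_const (2 * (M + 2) / ε)
      simpa using this)
    (by
      filter_upwards [hw, hM, H.defect_nonneg,
        eventually_ge_atTop 1, eventually_ge_atTop (2 / ε)] with r hw hM hh hr hr2 hd
      have hr0 : 0 < r := by linarith
      have hw0 : 0 ≤ w r := (by positivity : 0 ≤ ε * r).trans hw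
      set h := F r - w r / r with hdef
      have e1 : r ^ 2 * (F₁ r * w r + w r / r ^ 2 - (1 + w r ^ 2) * h / r)
          = (r ^ 2 * F₁ r) * w r + w r - r * h - w r ^ 2 * (r * h) := by
        field_simp
        ring
      have hrh : 0 ≤ r * h := by positivity
      have hεr : 2 ≤ ε * r := by rw [div_le_iff₀ hε] at hr2; linarith
      have h1 : (r ^ 2 * F₁ r) * w r ≤ M * w r := by gcongr
      have h2 : w r * (ε * r) * (r * h) ≤ w r * w r * (r * h) := by gcongr
      have h3 : 2 * (M + 2) ≤ ε * (r ^ 2 * h) := by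
        have : 2 * (M + 2) / ε ≤ r ^ 2 * h := by linarith
        rw [div_le_iff₀ hε] at this
        linarith
      have h4 : ε / r ≤ ε := div_le_self hε.le hr
      have h5 : ε ≤ w r := le_trans (le_mul_of_one_le_right hε.le hr) hw
      have h6 : w r * (2 * (M + 2)) ≤ w r * (ε * (r ^ 2 * h)) := by gcongr
      have hwr2 : 2 ≤ w r * r := by nlinarith
      have h7 : 2 * (r * h) * 1 ≤ w r * (ε * r) * (r * h) / 2 := by
        have : 4 ≤ w r * (ε * r) := by nlinarith
        nlinarith
      nlinarith)
  filter_upwards [this] with r hr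
  linarith

end IsSlope

/-! ### Consequences of the expansion of `φ̇` -/

/-- Convergence at a single `z₀ > 0` gives the power series in `1 / z` a positive radius.
Analyticity of its sum is what allows the expansion to be differentiated. -/
lemma HasExpansionAtTop.exists_analyticAt {f : ℝ → ℝ} {Λ β : ℝ} (hf : HasExpansionAtTop f Λ β) :
    ∃ g : ℝ → ℝ, AnalyticAt ℝ g 0 ∧ g 0 = 0 ∧ ∀ᶠ z in atTop, f z = Λ * z + β + g z⁻¹ := by
  obtain ⟨c, hc, -⟩ := hf
  set c' : ℕ → ℝ := fun n => if n = 0 then 0 else c n with hc'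
  set p := FormalMultilinearSeries.ofScalars ℝ c' with hp
  have hsum : ∀ᶠ z in atTop, HasSum (fun n => c' n * z⁻¹ ^ n) (f z - (Λ * z + β)) := by
    filter_upwards [hc] with z hz
    rw [← hasSum_nat_add_iff' 1]
    simpa [hc', div_eq_mul_inv] using hz
  obtain ⟨z₀, hz₀, hz₀'⟩ := (hsum.and (eventually_gt_atTop 0)).exists
  have hrad : 0 < p.radius := by
    have : (Real.toNNReal z₀⁻¹ : ENNReal) ≤ p.radius := by
      refine p.le_radius_of_tendsto (l := 0) ?_
      have h1 := hz₀.summable.tendsto_atTop_zero.norm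
      simpa [hp, FormalMultilinearSeries.ofScalars_norm, abs_of_pos hz₀', abs_inv, hz₀'.le] using h1
    refine lt_of_lt_of_le ?_ this
    rw [ENNReal.coe_pos, Real.toNNReal_pos]
    exact inv_pos.2 hz₀'
  have heq : ∀ x, p.sum x = ∑' n, c' n * x ^ n := fun x => by
    have h := FormalMultilinearSeries.ofScalars_sum_eq (E := ℝ) c' x
    simp only [smul_eq_mul] at h
    exact h
  refine ⟨p.sum, (p.hasFPowerSeriesOnBall hrad).analyticAt, ?_, ?_⟩
  · rw [heq, tsum_eq_single 0 (fun n hn => by simp [hn])]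
    simp [hc']
  · filter_upwards [hsum] with z hz
    rw [heq, hz.tsum_eq]
    ring

lemma HasExpansionAtTop.exists_abs_sub_le {f : ℝ → ℝ} {Λ β : ℝ}
    (hf : HasExpansionAtTop f Λ β) :
    ∃ A > 0, (∀ᶠ z in atTop, |f z - (Λ * z + β)| ≤ A / z) ∧
      ∀ᶠ z in atTop, |deriv f z - Λ| ≤ A / z ^ 2 := by
  obtain ⟨g, hg, hg0, hfg⟩ := hf.exists_analyticAt
  have hinv : Tendsto (fun z : ℝ => z⁻¹) atTop (𝓝 0) := tendsto_inv_atTop_zero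
  have hO : (fun x => g x) =O[𝓝 0] fun x => x := by
    simpa [hg0] using hg.differentiableAt.isBigO_sub
  obtain ⟨A, hA, hgA⟩ := hO.exists_pos
  have hd : ∀ᶠ x in 𝓝 (0 : ℝ), |deriv g x| < |deriv g 0| + 1 :=
    hg.deriv.continuousAt.abs.eventually_lt_const (by linarith)
  refine ⟨A + (|deriv g 0| + 1), by positivity, ?_, ?_⟩
  · filter_upwards [hfg, hinv.eventually hgA.bound, eventually_gt_atTop 0] with z h1 h2 hz
    rw [h1, add_sub_cancel_left]
    have h3 : |g z⁻¹| ≤ A * z⁻¹ := by simpa [abs_of_pos hz] using h2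
    rw [div_eq_mul_inv]
    refine h3.trans (mul_le_mul_of_nonneg_right ?_ (by positivity))
    linarith [abs_nonneg (deriv g 0)]
  · obtain ⟨z₁, hz₁⟩ := eventually_atTop.1 hfg
    filter_upwards [eventually_gt_atTop z₁, hinv.eventually hd,
      hinv.eventually hg.eventually_analyticAt, eventually_gt_atTop 0] with z h1 h2 h3 hz
    have he : f =ᶠ[𝓝 z] fun z => Λ * z + β + g z⁻¹ := by
      filter_upwards [lt_mem_nhds h1] with y hy using hz₁ y hy.le
    have hder : HasDerivAt (fun z => Λ * z + β + g z⁻¹)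
        (Λ * 1 + deriv g z⁻¹ * (-(z ^ 2)⁻¹)) z :=
      (((hasDerivAt_id z).const_mul Λ).add_const β).add
        (h3.differentiableAt.hasDerivAt.comp z (hasDerivAt_inv hz.ne'))
    rw [he.deriv_eq, hder.deriv, mul_one, add_sub_cancel_left, abs_mul, abs_neg,
      abs_of_pos (by positivity : 0 < (z ^ 2)⁻¹), div_eq_mul_inv]
    gcongr
    linarith

lemma exists_abs_le_add_of_abs_deriv_le {f f' E E' : ℝ → ℝ}
    (hf : ∀ᶠ r in atTop, HasDerivAt f (f' r) r) (hE : ∀ᶠ r in atTop, HasDerivAt E (E' r) r)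
    (hle : ∀ᶠ r in atTop, |f' r| ≤ E' r) : ∃ c, ∀ᶠ r in atTop, |f r| ≤ E r + c := by
  obtain ⟨r₁, h₁⟩ := eventually_atTop.1 (hf.and (hE.and hle))
  have hmono : ∀ σ : ℝ, |σ| = 1 → MonotoneOn (fun r => E r + σ * f r) (Set.Ici r₁) := by
    intro σ hσ
    refine monotoneOn_of_hasDerivWithinAt_nonneg (f' := fun r => E' r + σ * f' r)
        (convex_Ici _) ?_ ?_ ?_
    · intro r hr
      exact ((h₁ r hr).2.1.add ((h₁ r hr).1.const_mul σ)).continuousAt.continuousWithinAt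
    · intro r hr
      rw [interior_Ici] at hr
      exact ((h₁ r hr.le).2.1.add ((h₁ r hr.le).1.const_mul σ)).hasDerivWithinAt
    · intro r hr
      rw [interior_Ici] at hr
      have h2 : |σ * f' r| = |f' r| := by rw [abs_mul, hσ, one_mul]
      have h3 := neg_abs_le (σ * f' r)
      have := (h₁ r hr.le).2.2
      linarith
  refine ⟨|f r₁| - E r₁, ?_⟩
  filter_upwards [eventually_ge_atTop r₁] with r hr
  have h1 := hmono 1 (by simp) Set.self_mem_Ici hr hr
  have h2 := hmono (-1) (by simp) Set.self_mem_Ici hr hr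
  simp only at h1 h2
  have h3 := le_abs_self (f r₁)
  have h4 := neg_abs_le (f r₁)
  rw [abs_le]
  constructor <;> linarith

/-- If `f = φ̇` is of linear growth with slope `Λ`, then `f² - 2 Λ φ` grows at most
logarithmically. -/
lemma exists_abs_sq_sub_le {φ f : ℝ → ℝ} {Λ β A : ℝ} (hA : 0 < A)
    (hφ : ∀ᶠ z in atTop, HasDerivAt φ (f z) z)
    (hf : ∀ᶠ z in atTop, HasDerivAt f (deriv f z) z)
    (h0 : ∀ᶠ z in atTop, |f z - (Λ * z + β)| ≤ A / z)
    (h1 : ∀ᶠ z in atTop, |deriv f z - Λ| ≤ A / z ^ 2) :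
    ∃ B > 0, ∀ᶠ z in atTop, |f z ^ 2 - 2 * Λ * φ z| ≤ B * Real.log z := by
  set K := |Λ| + |β| + A with hK
  -- The derivative `2 f (f' - Λ)` is `O(z) · O(z⁻²)`, hence bounded by a multiple of `1 / z`.
  obtain ⟨c, hc⟩ := exists_abs_le_add_of_abs_deriv_le (f := fun z => f z ^ 2 - 2 * Λ * φ z)
    (f' := fun z => 2 * f z * (deriv f z - Λ)) (E := fun z => 2 * K * A * Real.log z)
    (E' := fun z => 2 * K * A * z⁻¹)
    (by
      filter_upwards [hφ, hf] with z h2 h3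
      refine ((h3.pow 2).sub (h2.const_mul (2 * Λ))).congr_deriv ?_
      simp
      ring)
    (by
      filter_upwards [eventually_gt_atTop 0] with z hz
      exact (Real.hasDerivAt_log hz.ne').const_mul _)
    (by
      filter_upwards [h0, h1, eventually_ge_atTop 1] with z h2 h3 hz
      have hz0 : 0 < z := by linarith
      have h4 : |f z| ≤ K * z := by
        have e : f z = (f z - (Λ * z + β)) + (Λ * z + β) := by ring
        have h5 : A / z ≤ A * z := (div_le_self hA.le hz).trans (le_mul_of_one_le_right hA.le hz)
        have h6 : |Λ * z + β| ≤ |Λ| * z + |β| * z := by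
          refine (abs_add_le _ _).trans ?_
          rw [abs_mul, abs_of_pos hz0]
          gcongr
          exact le_mul_of_one_le_right (abs_nonneg _) hz
        calc |f z| ≤ |f z - (Λ * z + β)| + |Λ * z + β| := by
              conv_lhs => rw [e]
              exact abs_add_le _ _
          _ ≤ A * z + (|Λ| * z + |β| * z) := by gcongr; exact h2.trans h5
          _ = K * z := by rw [hK]; ring
      rw [abs_mul, abs_mul, abs_two]
      calc 2 * |f z| * |deriv f z - Λ| ≤ 2 * (K * z) * (A / z ^ 2) := by gcongr
        _ = 2 * K * A * z⁻¹ := by field_simp)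
  have hK0 : 0 < K := by positivity
  refine ⟨2 * K * A + |c|, by positivity, ?_⟩
  filter_upwards [hc, Real.tendsto_log_atTop.eventually_ge_atTop 1] with z h2 h3
  have h4 := le_abs_self c
  have h5 : |c| ≤ |c| * Real.log z := le_mul_of_one_le_right (abs_nonneg _) h3
  linarith

/-! ### Integration of the two asymptotic equations -/

lemma hasDerivAt_exp_neg_mul_sq (Λ r : ℝ) :
    HasDerivAt (fun r => Real.exp (-(Λ * r ^ 2)))
      (Real.exp (-(Λ * r ^ 2)) * (-(Λ * (2 * r)))) r := by
  have h := (((hasDerivAt_pow 2 r).const_mul Λ).neg).exp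
  simpa using h

/-- The asymptotic behaviour of a function with `Φ' = 2 Λ r Φ + O(r³)`. -/
lemma exists_isBigO_exp {Φ Φ' : ℝ → ℝ} {Λ K : ℝ} (hΛ : 0 < Λ)
    (hΦ : ∀ᶠ r in atTop, HasDerivAt Φ (Φ' r) r)
    (hK : ∀ᶠ r in atTop, |Φ' r - 2 * Λ * r * Φ r| ≤ K * r ^ 3)
    (hgrow : ∀ N, ∀ᶠ r in atTop, N * r ≤ Φ' r) :
    ∃ C : ℝ, 0 < C ∧
      (fun r : ℝ => Φ r - C * Real.exp (Λ * r ^ 2)) =O[atTop] fun r : ℝ => r ^ 2 := by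
  -- Integrating factor; `E` is the exact tail integral of `K r³ exp(-Λ r²)`.
  obtain ⟨C, hC⟩ := exists_limit_of_abs_deriv_le (f := fun r => Φ r * Real.exp (-(Λ * r ^ 2)))
    (f' := fun r => (Φ' r - 2 * Λ * r * Φ r) * Real.exp (-(Λ * r ^ 2)))
    (E := fun r => K / (2 * Λ ^ 2) * ((Λ * r ^ 2 + 1) * Real.exp (-(Λ * r ^ 2))))
    (E' := fun r => -(K * r ^ 3 * Real.exp (-(Λ * r ^ 2))))
    (by
      filter_upwards [hΦ] with r h
      refine (h.mul (hasDerivAt_exp_neg_mul_sq Λ r)).congr_deriv ?_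
      ring)
    (Eventually.of_forall fun r => by
      have h := (((((hasDerivAt_pow 2 r).const_mul Λ).add_const 1).mul
        (hasDerivAt_exp_neg_mul_sq Λ r)).const_mul (K / (2 * Λ ^ 2)))
      refine h.congr_deriv ?_
      simp
      field_simp
      ring)
    (by
      filter_upwards [hK] with r h
      rw [abs_mul, neg_neg, abs_of_pos (Real.exp_pos _)]
      gcongr)
    (by
      have h1 : Tendsto (fun r : ℝ => Λ * r ^ 2) atTop atTop :=
        (tendsto_pow_atTop two_ne_zero).const_mul_atTop hΛ
      have h2 := (Real.tendsto_pow_mul_exp_neg_atTop_nhds_zero 1).comp h1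
      have h3 := (Real.tendsto_pow_mul_exp_neg_atTop_nhds_zero 0).comp h1
      have h4 := (h2.add h3).const_mul (K / (2 * Λ ^ 2))
      rw [add_zero, mul_zero] at h4
      refine h4.congr fun r => ?_
      simp only [Function.comp]
      ring)
  set L := |K| / (2 * Λ ^ 2) * (Λ + 1) with hL
  have hmain : ∀ᶠ r in atTop, |Φ r - C * Real.exp (Λ * r ^ 2)| ≤ L * r ^ 2 := by
    filter_upwards [hC, eventually_ge_atTop 1] with r h hr
    have he : Real.exp (-(Λ * r ^ 2)) * Real.exp (Λ * r ^ 2) = 1 := by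
      rw [← Real.exp_add]; simp
    have e1 : Φ r - C * Real.exp (Λ * r ^ 2)
        = (Φ r * Real.exp (-(Λ * r ^ 2)) - C) * Real.exp (Λ * r ^ 2) := by
      rw [sub_mul, mul_assoc, he, mul_one]
    rw [e1, abs_mul, abs_of_pos (Real.exp_pos (Λ * r ^ 2))]
    calc _ ≤ K / (2 * Λ ^ 2) * ((Λ * r ^ 2 + 1) * Real.exp (-(Λ * r ^ 2)))
            * Real.exp (Λ * r ^ 2) := by gcongr
      _ = K / (2 * Λ ^ 2) * (Λ * r ^ 2 + 1) := by
        rw [mul_assoc, mul_assoc, he, mul_one]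
      _ ≤ |K| / (2 * Λ ^ 2) * (Λ * r ^ 2 + r ^ 2) := by
        gcongr
        · exact le_abs_self K
        · nlinarith
      _ = L * r ^ 2 := by rw [hL]; ring
  refine ⟨C, ?_, ?_⟩
  -- If `C ≤ 0`, the estimate gives `Φ ≤ L r²`, whereas `hgrow` makes `Φ` exceed `(L + 1) r²` up to
  -- a constant.
  · by_contra! hC0
    obtain ⟨r₁, h₁⟩ := eventually_atTop.1 ((hgrow (2 * (L + 1))).and hΦ)
    have hmono : MonotoneOn (fun r => Φ r - (L + 1) * r ^ 2) (Set.Ici r₁) := by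
      have hd : ∀ r, HasDerivAt (fun r : ℝ => (L + 1) * r ^ 2) ((L + 1) * (2 * r)) r := fun r => by
        simpa using (hasDerivAt_pow 2 r).const_mul (L + 1)
      refine monotoneOn_of_hasDerivWithinAt_nonneg (f' := fun r => Φ' r - (L + 1) * (2 * r))
        (convex_Ici _) ?_ ?_ ?_
      · intro r hr
        exact ((h₁ r hr).2.sub (hd r)).continuousAt.continuousWithinAt
      · intro r hr
        rw [interior_Ici] at hr
        exact ((h₁ r hr.le).2.sub (hd r)).hasDerivWithinAt
      · intro r hr
        rw [interior_Ici] at hr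
        have := (h₁ r hr.le).1
        linarith
    obtain ⟨r, h2, h3, h4⟩ := (hmain.and ((eventually_ge_atTop r₁).and
      ((tendsto_pow_atTop two_ne_zero).eventually_gt_atTop (-(Φ r₁ - (L + 1) * r₁ ^ 2))))).exists
    have h5 := hmono Set.self_mem_Ici h3 h3
    have h6 : C * Real.exp (Λ * r ^ 2) ≤ 0 :=
      mul_nonpos_of_nonpos_of_nonneg hC0 (Real.exp_pos _).le
    have h7 := (abs_le.1 h2).2
    simp only at h5
    linarith
  · refine IsBigO.of_bound L ?_
    filter_upwards [hmain] with r h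
    rwa [Real.norm_eq_abs, Real.norm_of_nonneg (by positivity)]

variable {F F₁ w : ℝ → ℝ} in
/-- The asymptotic behaviour of the primitive `G` of `w / F` when `F = β + O(r⁻²)`. -/
lemma IsSlope.exists_isBigO_log (H : IsSlope F F₁ w) {G : ℝ → ℝ} {β A : ℝ} (hβ : 0 < β)
    (hG : ∀ᶠ r in atTop, HasDerivAt G (w r / F r) r)
    (hF : ∀ᶠ r in atTop, |F r - β| ≤ A / r ^ 2)
    (hF₁ : ∀ᶠ r in atTop, F₁ r ≤ A / r ^ 4) :
    ∃ c : ℝ, (fun r : ℝ => G r - (r ^ 2 / 2 - 1 / β ^ 2 * Real.log r + c))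
      =O[atTop] fun r : ℝ => (r ^ 2)⁻¹ := by
  obtain ⟨K, hK⟩ := H.exists_sq_mul_defect_le (M := |A|) (by
    filter_upwards [hF₁, eventually_ge_atTop 1] with r h hr
    have hr0 : 0 < r := by linarith
    calc r ^ 2 * F₁ r ≤ r ^ 2 * (A / r ^ 4) := by gcongr
      _ = A / r ^ 2 := by field_simp
      _ ≤ |A| / r ^ 2 := by gcongr; exact le_abs_self A
      _ ≤ |A| := div_le_self (abs_nonneg _) (one_le_pow₀ hr))
  have hsmall : ∀ B : ℝ, ∀ᶠ r : ℝ in atTop, B / r ^ 2 ≤ β / 4 := fun B =>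
    ((tendsto_const_nhds (x := B)).div_atTop (tendsto_pow_atTop (α := ℝ) two_ne_zero)
      ).eventually_le_const (by positivity)
  have hbounds : ∀ᶠ r in atTop, 0 < r ∧ β / 2 ≤ F r ∧ F r ≤ 2 * β ∧ β / 2 ≤ w r / r ∧
      |w r / r - β| ≤ (A + K) / r ^ 2 ∧ 0 ≤ F r - w r / r ∧ F r - w r / r ≤ K / r ^ 2 := by
    filter_upwards [hF, hK, H.defect_nonneg, hsmall A, hsmall K, eventually_gt_atTop 0]
      with r h1 h2 h3 h4 h5 hr
    have h6 : F r - w r / r ≤ K / r ^ 2 := by rw [le_div_iff₀ (by positivity)]; linarith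
    have h7 := abs_le.1 h1
    refine ⟨hr, by linarith, by linarith, by linarith, ?_, h3, h6⟩
    rw [add_div, abs_le]
    constructor <;> linarith
  set B := (2 * β * |A + K| + β * |A|) * (4 / β ^ 4) with hB
  have hquot : ∀ᶠ r in atTop, |r / (F r * w r) - 1 / β ^ 2| ≤ B / r ^ 2 := by
    filter_upwards [hbounds, hF] with r ⟨hr, h1, h2, h3, h4, h5, h6⟩ h7
    have hF0 : 0 < F r := by linarith
    have hx0 : 0 < w r / r := by linarith
    set x := w r / r with hx
    have hwx : w r = r * x := by rw [hx]; field_simp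
    have e : r / (F r * w r) - 1 / β ^ 2 = -(F r * (x - β) + β * (F r - β)) / (F r * x * β ^ 2) := by
      rw [hwx]; field_simp; ring
    rw [e, abs_div, abs_neg, abs_of_pos (by positivity : 0 < F r * x * β ^ 2)]
    have h8 : |F r * (x - β) + β * (F r - β)| ≤ (2 * β * |A + K| + β * |A|) / r ^ 2 := by
      calc _ ≤ |F r * (x - β)| + |β * (F r - β)| := abs_add_le _ _
        _ = F r * |x - β| + β * |F r - β| := by
          rw [abs_mul, abs_mul, abs_of_pos hF0, abs_of_pos hβ]
        _ ≤ 2 * β * (|A + K| / r ^ 2) + β * (|A| / r ^ 2) := by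
          gcongr
          · exact h4.trans (by gcongr; exact le_abs_self _)
          · exact h7.trans (by gcongr; exact le_abs_self _)
        _ = _ := by ring
    have h9 : β ^ 4 / 4 ≤ F r * x * β ^ 2 := by
      calc β ^ 4 / 4 = β / 2 * (β / 2) * β ^ 2 := by ring
        _ ≤ _ := by gcongr
    calc _ ≤ (2 * β * |A + K| + β * |A|) / r ^ 2 / (β ^ 4 / 4) := by gcongr
      _ = B / r ^ 2 := by rw [hB]; field_simp
  set D := B + |A| * (4 / β ^ 2) + |K| * (8 / β ^ 3) with hD
  -- Subtracting `r / (F w)` cancels the term `-r h / F` of `G' - r`, for which the bound `h =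
  -- O(r⁻²)` yields only `O(1/r)`. What remains is `-1/(F w) + 1/(β² r)` and two further terms, all
  -- `O(r⁻³)`.
  obtain ⟨c, hc⟩ := exists_limit_of_abs_deriv_le
    (f := fun r => G r - r / (F r * w r) - r ^ 2 / 2 + 1 / β ^ 2 * Real.log r)
    (f' := fun r => -(r / (F r * w r) - 1 / β ^ 2) / r + r * F₁ r / F r ^ 2
      + r * (F r - w r / r) / (w r ^ 2 * F r))
    (E := fun r => D / 2 * (r ^ 2)⁻¹) (E' := fun r => -(D / r ^ 3))
    (by
      filter_upwards [hbounds, hG, H.deriv_slope, H.deriv_force]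
        with r ⟨hr, h1, h2, h3, _⟩ hG hw hF
      have hF0 : 0 < F r := by linarith
      have hw0 : 0 < w r := by
        have : 0 < w r / r := by linarith
        exact (div_pos_iff_of_pos_right hr).1 this
      refine (((hG.sub ((hasDerivAt_id r).div (hF.mul hw) (mul_pos hF0 hw0).ne')).sub
        ((hasDerivAt_pow 2 r).div_const 2)).add
        ((Real.hasDerivAt_log hr.ne').const_mul (1 / β ^ 2))).congr_deriv ?_
      simp only [id, Pi.mul_apply]
      field_simp
      push_cast
      ring)
    (by
      filter_upwards [eventually_gt_atTop 0] with r hr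
      refine (((hasDerivAt_pow 2 r).inv (by positivity)).const_mul (D / 2)).congr_deriv ?_
      simp
      field_simp)
    (by
      filter_upwards [hbounds, hquot, hF₁, H.deriv_nonneg]
        with r ⟨hr, h1, h2, h3, h4, h5, h6⟩ h7 h8 h9
      have hF0 : 0 < F r := by linarith
      have hx0 : 0 < w r / r := by linarith
      have hw0 : 0 < w r := (div_pos_iff_of_pos_right hr).1 hx0
      rw [neg_neg]
      have t1 : |-(r / (F r * w r) - 1 / β ^ 2) / r| ≤ B / r ^ 3 := by
        rw [abs_div, abs_neg, abs_of_pos hr]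
        calc _ ≤ B / r ^ 2 / r := by gcongr
          _ = _ := by field_simp
      have t2 : |r * F₁ r / F r ^ 2| ≤ |A| * (4 / β ^ 2) / r ^ 3 := by
        rw [abs_of_nonneg (by positivity)]
        calc _ ≤ r * (|A| / r ^ 4) / (β / 2) ^ 2 := by
              gcongr
              exact h8.trans (by gcongr; exact le_abs_self _)
          _ = _ := by field_simp; norm_num
      have t3 : |r * (F r - w r / r) / (w r ^ 2 * F r)| ≤ |K| * (8 / β ^ 3) / r ^ 3 := by
        rw [abs_of_nonneg (by positivity)]
        have h10 : β / 2 * r ≤ w r := by rwa [le_div_iff₀ hr] at h3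
        calc _ ≤ r * (|K| / r ^ 2) / ((β / 2 * r) ^ 2 * (β / 2)) := by
              gcongr
              exact h6.trans (by gcongr; exact le_abs_self _)
          _ = _ := by field_simp; norm_num
      calc _ ≤ B / r ^ 3 + |A| * (4 / β ^ 2) / r ^ 3 + |K| * (8 / β ^ 3) / r ^ 3 :=
            (abs_add_three _ _ _).trans (by gcongr)
        _ = D / r ^ 3 := by rw [hD]; ring)
    (by
      have := (tendsto_inv_atTop_zero.comp (tendsto_pow_atTop (α := ℝ) two_ne_zero)).const_mul
        (D / 2)
      simpa using this)
  -- The extra `1 / β²` is the limit of the subtracted `r / (F w)`.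
  refine ⟨c + 1 / β ^ 2, IsBigO.of_bound (D / 2 + B) ?_⟩
  filter_upwards [hc, hquot, eventually_gt_atTop 0] with r h1 h2 hr
  rw [Real.norm_eq_abs, Real.norm_of_nonneg (by positivity), add_mul]
  rw [div_eq_mul_inv B] at h2
  have h3 := abs_le.1 h1
  have h4 := abs_le.1 h2
  rw [abs_le]
  constructor <;> linarith

/-! ### Calculus on the interval of heights -/

lemma isOpen_heights (a : EReal) : IsOpen (heights a) :=
  isOpen_lt continuous_const continuous_coe_real_ereal

lemma ordConnected_heights (a : EReal) : (heights a).OrdConnected :=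
  ⟨fun _ hx _ _ _ hz => lt_of_lt_of_le (a := a) hx (EReal.coe_le_coe_iff.2 hz.1)⟩

lemma eventually_mem_heights {a : EReal} (ha : a ≠ ⊤) : ∀ᶠ z : ℝ in atTop, z ∈ heights a := by
  obtain ⟨y, hy, -⟩ := EReal.lt_iff_exists_real_btwn.1 (lt_top_iff_ne_top.2 ha)
  filter_upwards [eventually_ge_atTop y] with z hz
  exact lt_of_lt_of_le hy (EReal.coe_le_coe_iff.2 hz)

section Heights

variable {a : EReal} {φ : ℝ → ℝ} (hφ : ContDiffOn ℝ ∞ φ (heights a))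
include hφ

lemma hasDerivAt_of_mem_heights {z : ℝ} (hz : z ∈ heights a) : HasDerivAt φ (deriv φ z) z :=
  ((hφ.contDiffAt ((isOpen_heights a).mem_nhds hz)).differentiableAt (by simp)).hasDerivAt

lemma contDiffOn_deriv : ContDiffOn ℝ ∞ (deriv φ) (heights a) :=
  ((contDiffOn_infty_iff_deriv_of_isOpen (isOpen_heights a)).1 hφ).2

lemma hasDerivAt_deriv_of_mem_heights {z : ℝ} (hz : z ∈ heights a) :
    HasDerivAt (deriv φ) (deriv (deriv φ) z) z :=
  hasDerivAt_of_mem_heights (contDiffOn_deriv hφ) hz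

lemma monotoneOn_deriv (hφ₂ : ∀ z ∈ heights a, 0 ≤ deriv (deriv φ) z) :
    MonotoneOn (deriv φ) (heights a) := by
  refine monotoneOn_of_deriv_nonneg (ordConnected_heights a).convex
    (contDiffOn_deriv hφ).continuousOn
    ?_ (fun z hz => hφ₂ z (interior_subset hz))
  exact ((contDiffOn_deriv hφ).differentiableOn (by simp)).mono interior_subset

lemma hasDerivAt_integral_inv_deriv (hφ₁ : ∀ z ∈ heights a, 0 < deriv φ z) {z₀ z : ℝ}
    (hz₀ : z₀ ∈ heights a) (hz : z ∈ heights a) :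
    HasDerivAt (fun z => ∫ ξ in z₀..z, 1 / deriv φ ξ) (1 / deriv φ z) z := by
  have hc : ContinuousOn (fun ξ => 1 / deriv φ ξ) (heights a) :=
    continuousOn_const.div (contDiffOn_deriv hφ).continuousOn fun ξ hξ => (hφ₁ ξ hξ).ne'
  exact intervalIntegral.integral_hasDerivAt_right
    ((hc.mono ((ordConnected_heights a).uIcc_subset hz₀ hz)).intervalIntegrable)
    (hc.stronglyMeasurableAtFilter (isOpen_heights a) z hz)
    (hc.continuousAt ((isOpen_heights a).mem_nhds hz))

end Heights

/-! ### The profile equation and its asymptotics -/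

/-- `u`, with derivative `w`, is a solution on `I` of the profile equation
`u'' = (1 + u'²) (φ̇(u) - u' / r)`. -/
structure IsProfile (φ : ℝ → ℝ) (a : EReal) (I : Set ℝ) (u w : ℝ → ℝ) : Prop where
  mem_heights : ∀ r ∈ I, u r ∈ heights a
  deriv_profile : ∀ r ∈ I, HasDerivAt u (w r) r
  deriv_slope : ∀ r ∈ I, HasDerivAt w ((1 + w r ^ 2) * (deriv φ (u r) - w r / r)) r

namespace IsProfile

variable {φ : ℝ → ℝ} {a : EReal} {u w : ℝ → ℝ} {r₀ : ℝ}

lemma monotoneOn {I : Set ℝ} (H : IsProfile φ a I u w) (hI : I.OrdConnected)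
    (hw : ∀ r ∈ I, 0 ≤ w r) : MonotoneOn u I :=
  monotoneOn_of_hasDerivWithinAt_nonneg hI.convex
    (fun r hr => (H.deriv_profile r hr).continuousAt.continuousWithinAt)
    (fun r hr => (H.deriv_profile r (interior_subset hr)).hasDerivWithinAt)
    (fun r hr => hw r (interior_subset hr))

lemma isSlope (H : IsProfile φ a (Set.Ioi r₀) u w) (hw : ∀ r ∈ Set.Ioi r₀, 0 ≤ w r)
    (hφ : ContDiffOn ℝ ∞ φ (heights a)) (hφ₁ : ∀ z ∈ heights a, 0 < deriv φ z)
    (hφ₂ : ∀ z ∈ heights a, 0 ≤ deriv (deriv φ) z) :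
    IsSlope (fun r => deriv φ (u r)) (fun r => deriv (deriv φ) (u r)) w where
  deriv_slope := (eventually_gt_atTop r₀).mono fun r hr => H.deriv_slope r hr
  deriv_force := (eventually_gt_atTop r₀).mono fun r hr =>
    (hasDerivAt_deriv_of_mem_heights hφ (H.mem_heights r hr)).comp r (H.deriv_profile r hr)
  nonneg := (eventually_gt_atTop r₀).mono hw
  deriv_nonneg := (eventually_gt_atTop r₀).mono fun r hr => hφ₂ _ (H.mem_heights r hr)
  force_ge := by
    have hr₁ : r₀ + 1 ∈ Set.Ioi r₀ := by simp
    refine ⟨deriv φ (u (r₀ + 1)), hφ₁ _ (H.mem_heights _ hr₁), ?_⟩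
    filter_upwards [eventually_ge_atTop (r₀ + 1)] with r hr
    have hr' : r ∈ Set.Ioi r₀ := lt_of_lt_of_le hr₁ hr
    exact monotoneOn_deriv hφ hφ₂ (H.mem_heights _ hr₁) (H.mem_heights _ hr')
      (H.monotoneOn Set.ordConnected_Ioi hw hr₁ hr' hr)

lemma exists_mul_sq_le (H : IsProfile φ a (Set.Ioi r₀) u w) {ε : ℝ} (hε : 0 < ε)
    (hw : ∀ᶠ r in atTop, ε * r ≤ w r) : ∀ᶠ r in atTop, ε / 4 * r ^ 2 ≤ u r := by
  obtain ⟨r₁, h₁⟩ := eventually_atTop.1 (hw.and (eventually_gt_atTop r₀))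
  have hd : ∀ r, HasDerivAt (fun r : ℝ => ε / 2 * r ^ 2) (ε / 2 * (2 * r)) r := fun r => by
    simpa using (hasDerivAt_pow 2 r).const_mul (ε / 2)
  have hmono : MonotoneOn (fun r => u r - ε / 2 * r ^ 2) (Set.Ici r₁) := by
    refine monotoneOn_of_hasDerivWithinAt_nonneg (f' := fun r => w r - ε / 2 * (2 * r))
      (convex_Ici _) ?_ ?_ ?_
    · intro r hr
      exact ((H.deriv_profile r (h₁ r hr).2).sub (hd r)).continuousAt.continuousWithinAt
    · intro r hr
      rw [interior_Ici] at hr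
      exact ((H.deriv_profile r (h₁ r hr.le).2).sub (hd r)).hasDerivWithinAt
    · intro r hr
      rw [interior_Ici] at hr
      have := (h₁ r hr.le).1
      linarith
  filter_upwards [eventually_ge_atTop r₁, (((tendsto_pow_atTop (α := ℝ) two_ne_zero)
    |>.const_mul_atTop (by positivity : 0 < ε / 4))).eventually_ge_atTop
      (-(u r₁ - ε / 2 * r₁ ^ 2))] with r h2 h3
  have h4 := hmono Set.self_mem_Ici h2 h2
  simp only at h4
  linarith

theorem asymptotics_of_pos (H : IsProfile φ a (Set.Ioi r₀) u w)
    (hw : ∀ r ∈ Set.Ioi r₀, 0 ≤ w r) (ha : a ≠ ⊤)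
    (hφ : ContDiffOn ℝ ∞ φ (heights a)) (hφ₁ : ∀ z ∈ heights a, 0 < deriv φ z)
    (hφ₂ : ∀ z ∈ heights a, 0 ≤ deriv (deriv φ) z) {Λ β : ℝ}
    (hexp : HasExpansionAtTop (deriv φ) Λ β) (hΛ : 0 < Λ) :
    ∃ C : ℝ, 0 < C ∧
      (fun r : ℝ => φ (u r) - C * Real.exp (Λ * r ^ 2)) =O[atTop] (fun r : ℝ => r ^ 2) := by
  have S := H.isSlope hw hφ hφ₁ hφ₂
  obtain ⟨ε, hε, hεw⟩ := S.exists_mul_le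
  obtain ⟨A, hA, hA0, hA1⟩ := hexp.exists_abs_sub_le
  have hu : Tendsto u atTop atTop :=
    tendsto_atTop_mono' _ (H.exists_mul_sq_le hε hεw)
      ((tendsto_pow_atTop two_ne_zero).const_mul_atTop (by positivity))
  have hmem := eventually_mem_heights ha
  obtain ⟨B, hB, hB'⟩ := exists_abs_sq_sub_le hA
    (hmem.mono fun z hz => hasDerivAt_of_mem_heights hφ hz)
    (hmem.mono fun z hz => hasDerivAt_deriv_of_mem_heights hφ hz) hA0 hA1
  have hF : Tendsto (deriv φ) atTop atTop := by
    refine tendsto_atTop_mono' _ ?_ (tendsto_atTop_add_const_right _ (β - A)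
      (tendsto_id.const_mul_atTop hΛ))
    filter_upwards [hA0, eventually_ge_atTop 1] with z hz h1
    have h2 := (abs_le.1 hz).1
    have h3 : A / z ≤ A := div_le_self hA.le h1
    simp only [id]
    linarith
  have hF₁ : ∀ᶠ z in atTop, deriv (deriv φ) z ≤ Λ + A := by
    filter_upwards [hA1, eventually_ge_atTop 1] with z hz h1
    have h2 := (abs_le.1 hz).2
    have h3 : A / z ^ 2 ≤ A := div_le_self hA.le (one_le_pow₀ h1)
    linarith
  have hlin : ∀ᶠ z in atTop, deriv φ z ≤ (Λ + |β| + A) * z := by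
    filter_upwards [hA0, eventually_ge_atTop 1] with z hz h1
    have h2 := (abs_le.1 hz).2
    have h3 : A / z ≤ A := div_le_self hA.le h1
    have h4 := le_abs_self β
    have h5 : |β| ≤ |β| * z := le_mul_of_one_le_right (abs_nonneg _) h1
    have h6 : A ≤ A * z := le_mul_of_one_le_right hA.le h1
    linarith
  obtain ⟨K, hK⟩ := S.exists_defect_mul_force_le
    (fun δ hδ => by
      filter_upwards [hu.eventually hF₁,
        hu.eventually (hF.eventually_ge_atTop ((Λ + A) / δ))] with r h1 h2
      rw [div_le_iff₀ hδ] at h2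
      linarith) (hu.eventually hF₁)
  -- `h ≥ 0` and linear growth of `φ̇` give `w / u ≤ const · r`, so `log u = O(r²)`; this turns the
  -- logarithmic error in `φ̇² - 2Λφ` into a power of `r`.
  obtain ⟨c, hc⟩ := exists_abs_le_add_of_abs_deriv_le (f := fun r => Real.log (u r))
    (f' := fun r => w r / u r) (E := fun r => (Λ + |β| + A) * (r ^ 2 / 2))
    (E' := fun r => (Λ + |β| + A) * r)
    (by
      filter_upwards [hu.eventually_gt_atTop 0, eventually_gt_atTop r₀] with r h1 h2
      exact (H.deriv_profile r h2).log h1.ne')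
    (Eventually.of_forall fun r => by
      have := ((hasDerivAt_pow 2 r).div_const 2).const_mul (Λ + |β| + A)
      simpa using this)
    (by
      filter_upwards [hu.eventually_gt_atTop 0, hu.eventually hlin, S.defect_nonneg, S.nonneg,
        eventually_gt_atTop 0] with r h1 h2 h3 h4 hr
      rw [abs_of_nonneg (by positivity), div_le_iff₀ h1]
      have h5 : w r / r ≤ (Λ + |β| + A) * u r := by linarith
      rw [div_le_iff₀ hr] at h5
      linarith)
  refine exists_isBigO_exp (Φ' := fun r => deriv φ (u r) * w r)
    (K := B * ((Λ + |β| + A) + |c|) + |K|) hΛ ?_ ?_ ?_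
  · filter_upwards [eventually_gt_atTop r₀] with r hr
    exact (hasDerivAt_of_mem_heights hφ (H.mem_heights r hr)).comp r (H.deriv_profile r hr)
  · filter_upwards [hu.eventually hB', hK, hc, eventually_ge_atTop 1, S.defect_nonneg,
      hu.eventually (hF.eventually_ge_atTop 0)] with r h1 h2 h3 hr h4 h5
    have hr0 : 0 < r := by linarith
    have e : deriv φ (u r) * w r - 2 * Λ * r * φ (u r)
        = r * (deriv φ (u r) ^ 2 - 2 * Λ * φ (u r))
          - r * ((deriv φ (u r) - w r / r) * deriv φ (u r)) := by
      field_simp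
      ring
    have hr2 : 1 ≤ r ^ 2 := one_le_pow₀ hr
    have h6 : Real.log (u r) ≤ ((Λ + |β| + A) + |c|) * r ^ 2 := by
      have h7 := le_abs_self (Real.log (u r))
      have h8 := le_abs_self c
      have h9 : |c| ≤ |c| * r ^ 2 := le_mul_of_one_le_right (abs_nonneg _) hr2
      have h10 : 0 ≤ (Λ + |β| + A) * r ^ 2 := by positivity
      linarith
    have h7 : |(deriv φ (u r) - w r / r) * deriv φ (u r)| ≤ |K| * r ^ 2 := by
      rw [abs_of_nonneg (mul_nonneg h4 h5)]
      exact (h2.trans (le_abs_self K)).trans (le_mul_of_one_le_right (abs_nonneg _) hr2)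
    rw [e]
    calc _ ≤ |r * (deriv φ (u r) ^ 2 - 2 * Λ * φ (u r))|
          + |r * ((deriv φ (u r) - w r / r) * deriv φ (u r))| := abs_sub _ _
      _ ≤ r * (B * (((Λ + |β| + A) + |c|) * r ^ 2)) + r * (|K| * r ^ 2) := by
        rw [abs_mul, abs_mul r, abs_of_pos hr0]
        gcongr
        exact h1.trans (by gcongr)
      _ = _ := by ring
  · intro N
    filter_upwards [hεw, hu.eventually (hF.eventually_ge_atTop (|N| / ε)),
      eventually_gt_atTop 0] with r h1 h2 hr
    have h3 : 0 ≤ deriv φ (u r) := le_trans (by positivity) h2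
    calc N * r ≤ |N| * r := by gcongr; exact le_abs_self N
      _ = |N| / ε * (ε * r) := by field_simp
      _ ≤ deriv φ (u r) * w r := by gcongr

theorem asymptotics_of_eq_zero (H : IsProfile φ a (Set.Ioi r₀) u w)
    (hw : ∀ r ∈ Set.Ioi r₀, 0 ≤ w r)
    (hφ : ContDiffOn ℝ ∞ φ (heights a)) (hφ₁ : ∀ z ∈ heights a, 0 < deriv φ z)
    (hφ₂ : ∀ z ∈ heights a, 0 ≤ deriv (deriv φ) z) {β : ℝ}
    (hexp : HasExpansionAtTop (deriv φ) 0 β) {u₀ : ℝ} (hu₀ : u₀ ∈ heights a) :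
    ∃ c : ℝ, (fun r : ℝ => (∫ ξ in u₀..u r, 1 / deriv φ ξ)
      - (r ^ 2 / 2 - 1 / β ^ 2 * Real.log r + c)) =O[atTop] (fun r : ℝ => (r ^ 2)⁻¹) := by
  have S := H.isSlope hw hφ hφ₁ hφ₂
  have hβ : 0 < β := by
    obtain ⟨_, -, h | h⟩ := hexp
    · exact absurd h.1 (lt_irrefl _)
    · exact h.2.1
  obtain ⟨ε, hε, hεw⟩ := S.exists_mul_le
  obtain ⟨A, hA, hA0, hA1⟩ := hexp.exists_abs_sub_le
  have hur := H.exists_mul_sq_le hε hεw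
  have hu : Tendsto u atTop atTop :=
    tendsto_atTop_mono' _ hur ((tendsto_pow_atTop two_ne_zero).const_mul_atTop (by positivity))
  -- Since `u ≥ (ε/4) r²`, the errors `A / z` and `A / z²` become `O(r⁻²)` and `O(r⁻⁴)`; the sum
  -- serves as a common constant.
  refine S.exists_isBigO_log (A := A / (ε / 4) + A / (ε / 4) ^ 2) hβ ?_ ?_ ?_
  · filter_upwards [eventually_gt_atTop r₀] with r hr
    have h := (hasDerivAt_integral_inv_deriv hφ hφ₁ hu₀ (H.mem_heights r hr)).comp r
      (H.deriv_profile r hr)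
    refine h.congr_deriv ?_
    rw [one_div_mul_eq_div]
  · filter_upwards [hu.eventually hA0, hur, eventually_gt_atTop 0] with r h1 h2 hr
    rw [zero_mul, zero_add] at h1
    calc _ ≤ A / u r := h1
      _ ≤ A / (ε / 4 * r ^ 2) := by gcongr
      _ = A / (ε / 4) / r ^ 2 := by rw [div_div]
      _ ≤ _ := by gcongr; exact le_add_of_nonneg_right (by positivity)
  · filter_upwards [hu.eventually hA1, hur, eventually_gt_atTop 0] with r h1 h2 hr
    rw [sub_zero] at h1
    calc _ ≤ A / u r ^ 2 := (le_abs_self _).trans h1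
      _ ≤ A / (ε / 4 * r ^ 2) ^ 2 := by gcongr
      _ = A / (ε / 4) ^ 2 / r ^ 4 := by rw [mul_pow, div_div]; ring
      _ ≤ _ := by gcongr; exact le_add_of_nonneg_left (by positivity)

end IsProfile

/-! ### Partial derivatives of radial functions -/

lemma continuous_radius : Continuous radius := by
  unfold radius; fun_prop

lemma radius_nonneg (p : ℝ × ℝ) : 0 ≤ radius p := Real.sqrt_nonneg _

lemma radius_sq (p : ℝ × ℝ) : radius p ^ 2 = p.1 ^ 2 + p.2 ^ 2 := Real.sq_sqrt (by positivity)

lemma radius_mk_zero {r : ℝ} (hr : 0 ≤ r) : radius (r, 0) = r := by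
  simp [radius, Real.sqrt_sq hr]

lemma isOpen_annulus (R : ℝ) (ρ : EReal) : IsOpen (annulus R ρ) := by
  have : annulus R ρ = {p | R < radius p} ∩ {p | (radius p : EReal) < ρ} := by
    ext p
    simp [annulus, radii, radius_nonneg]
  rw [this]
  exact (isOpen_lt continuous_const continuous_radius).inter
    (isOpen_lt (continuous_coe_real_ereal.comp continuous_radius) continuous_const)

lemma hasDerivAt_radius_fst {p : ℝ × ℝ} (hp : 0 < radius p) :
    HasDerivAt (fun t => radius (t, p.2)) (p.1 / radius p) p.1 := by
  have h := ((hasDerivAt_pow 2 p.1).add_const (p.2 ^ 2)).sqrt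
    (by rw [← radius_sq]; positivity)
  refine h.congr_deriv ?_
  change _ / (2 * radius p) = _
  field_simp
  simp

lemma hasDerivAt_radius_snd {p : ℝ × ℝ} (hp : 0 < radius p) :
    HasDerivAt (fun t => radius (p.1, t)) (p.2 / radius p) p.2 := by
  have h := ((hasDerivAt_pow 2 p.2).const_add (p.1 ^ 2)).sqrt
    (by rw [← radius_sq]; positivity)
  refine h.congr_deriv ?_
  change _ / (2 * radius p) = _
  field_simp
  simp

lemma contDiffAt_radius {p : ℝ × ℝ} (hp : 0 < radius p) {n : WithTop ℕ∞} :
    ContDiffAt ℝ n radius p := by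
  unfold radius
  refine ContDiffAt.sqrt (by fun_prop) ?_
  rw [← radius_sq]
  positivity

section Congr

variable {f g : ℝ × ℝ → ℝ} {p : ℝ × ℝ}

lemma partialX_congr (h : f =ᶠ[𝓝 p] g) : partialX f p = partialX g p := by
  have hc : Tendsto (fun t : ℝ => (t, p.2)) (𝓝 p.1) (𝓝 p) := by
    have : Continuous fun t : ℝ => (t, p.2) := by fun_prop
    exact this.tendsto p.1
  exact Filter.EventuallyEq.deriv_eq (hc.eventually h)

lemma partialY_congr (h : f =ᶠ[𝓝 p] g) : partialY f p = partialY g p := by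
  have hc : Tendsto (fun t : ℝ => (p.1, t)) (𝓝 p.2) (𝓝 p) := by
    have : Continuous fun t : ℝ => (p.1, t) := by fun_prop
    exact this.tendsto p.2
  exact Filter.EventuallyEq.deriv_eq (hc.eventually h)

lemma eventuallyEq_partialX (h : f =ᶠ[𝓝 p] g) : partialX f =ᶠ[𝓝 p] partialX g :=
  h.eventuallyEq_nhds.mono fun _ hq => partialX_congr hq

lemma eventuallyEq_partialY (h : f =ᶠ[𝓝 p] g) : partialY f =ᶠ[𝓝 p] partialY g :=
  h.eventuallyEq_nhds.mono fun _ hq => partialY_congr hq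

end Congr

section Radial

variable {v w : ℝ → ℝ} {p : ℝ × ℝ}

lemma partialX_radial {d : ℝ} (hp : 0 < radius p) (hv : HasDerivAt v d (radius p)) :
    partialX (fun q => v (radius q)) p = d * (p.1 / radius p) :=
  (hv.comp p.1 (hasDerivAt_radius_fst hp)).deriv

lemma partialY_radial {d : ℝ} (hp : 0 < radius p) (hv : HasDerivAt v d (radius p)) :
    partialY (fun q => v (radius q)) p = d * (p.2 / radius p) :=
  (hv.comp p.2 (hasDerivAt_radius_snd hp)).deriv

lemma eventuallyEq_partialX_radial (hp : 0 < radius p)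
    (hv : ∀ᶠ r in 𝓝 (radius p), HasDerivAt v (w r) r) :
    partialX (fun q => v (radius q)) =ᶠ[𝓝 p] fun q => w (radius q) * (q.1 / radius q) := by
  filter_upwards [continuous_radius.continuousAt.eventually hv,
    continuous_radius.continuousAt.eventually (lt_mem_nhds hp)] with q h1 h2
  exact partialX_radial h2 h1

lemma eventuallyEq_partialY_radial (hp : 0 < radius p)
    (hv : ∀ᶠ r in 𝓝 (radius p), HasDerivAt v (w r) r) :
    partialY (fun q => v (radius q)) =ᶠ[𝓝 p] fun q => w (radius q) * (q.2 / radius q) := by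
  filter_upwards [continuous_radius.continuousAt.eventually hv,
    continuous_radius.continuousAt.eventually (lt_mem_nhds hp)] with q h1 h2
  exact partialY_radial h2 h1

variable {w' : ℝ} (hp : 0 < radius p) (hv : ∀ᶠ r in 𝓝 (radius p), HasDerivAt v (w r) r)
  (hw : HasDerivAt w w' (radius p))
include hp hv hw

/-- The Hessian of a radial function has eigenvalue `w'` in the radial direction and `w / r` in the
tangential one. -/
lemma partialX_partialX_radial : partialX (partialX fun q => v (radius q)) p =
    w' * (p.1 / radius p) ^ 2 + w (radius p) / radius p * (1 - (p.1 / radius p) ^ 2) := by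
  rw [partialX_congr (eventuallyEq_partialX_radial hp hv)]
  have h1 := hasDerivAt_radius_fst hp
  have h := (hw.comp p.1 h1).mul ((hasDerivAt_id p.1).div h1 hp.ne')
  refine h.deriv.trans ?_
  simp only [Function.comp, id, Prod.mk.eta, Pi.div_apply]
  field_simp

lemma partialY_partialY_radial : partialY (partialY fun q => v (radius q)) p =
    w' * (p.2 / radius p) ^ 2 + w (radius p) / radius p * (1 - (p.2 / radius p) ^ 2) := by
  rw [partialY_congr (eventuallyEq_partialY_radial hp hv)]
  have h1 := hasDerivAt_radius_snd hp
  have h := (hw.comp p.2 h1).mul ((hasDerivAt_id p.2).div h1 hp.ne')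
  refine h.deriv.trans ?_
  simp only [Function.comp, id, Prod.mk.eta, Pi.div_apply]
  field_simp

lemma partialY_partialX_radial : partialY (partialX fun q => v (radius q)) p =
    (w' - w (radius p) / radius p) * (p.1 / radius p) * (p.2 / radius p) := by
  rw [partialY_congr (eventuallyEq_partialX_radial hp hv)]
  have h1 := hasDerivAt_radius_snd hp
  have h := (hw.comp p.2 h1).mul ((hasDerivAt_const p.2 p.1).div h1 hp.ne')
  refine h.deriv.trans ?_
  simp only [Function.comp, Prod.mk.eta, Pi.div_apply]
  field_simp
  ring

/-- For a radial function, the minimal graph equation is the profile equation. -/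
lemma radial_equation_iff (F : ℝ) :
    (1 + partialX (fun q => v (radius q)) p ^ 2) * partialY (partialY fun q => v (radius q)) p
      + (1 + partialY (fun q => v (radius q)) p ^ 2)
        * partialX (partialX fun q => v (radius q)) p
      - 2 * partialY (fun q => v (radius q)) p * partialX (fun q => v (radius q)) p
        * partialY (partialX fun q => v (radius q)) p
      = F * (1 + partialX (fun q => v (radius q)) p ^ 2 + partialY (fun q => v (radius q)) p ^ 2)
    ↔ w' = (1 + w (radius p) ^ 2) * (F - w (radius p) / radius p) := by
  rw [partialX_partialX_radial hp hv hw, partialY_partialY_radial hp hv hw,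
    partialY_partialX_radial hp hv hw, partialX_radial hp hv.self_of_nhds,
    partialY_radial hp hv.self_of_nhds]
  have hcd : (p.1 / radius p) ^ 2 + (p.2 / radius p) ^ 2 = 1 := by
    rw [div_pow, div_pow, ← add_div, ← radius_sq, div_self (by positivity)]
  set c := p.1 / radius p
  set d := p.2 / radius p
  set k := w (radius p) / radius p
  set m := w (radius p)
  have hd : d ^ 2 = 1 - c ^ 2 := by linarith
  have e1 : (1 + (m * c) ^ 2) * (w' * d ^ 2 + k * (1 - d ^ 2))
      + (1 + (m * d) ^ 2) * (w' * c ^ 2 + k * (1 - c ^ 2))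
      - 2 * (m * d) * (m * c) * ((w' - k) * c * d) = w' + (1 + m ^ 2) * k := by
    have : 2 * (m * d) * (m * c) * ((w' - k) * c * d) = 2 * m ^ 2 * c ^ 2 * (w' - k) * d ^ 2 := by
      ring
    rw [this, mul_pow, mul_pow, hd]
    ring
  have e2 : 1 + (m * c) ^ 2 + (m * d) ^ 2 = 1 + m ^ 2 := by
    rw [mul_pow, mul_pow, hd]; ring
  rw [e1, e2]
  constructor <;> intro h <;> linarith

end Radial

/-! ### Rotational graphs and profiles -/

/-- The positive radii between `R` and `ρ`. -/
def posRadii (R : ℝ) (ρ : EReal) : Set ℝ := {r | 0 < r ∧ R < r ∧ (r : EReal) < ρ}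

lemma isOpen_posRadii (R : ℝ) (ρ : EReal) : IsOpen (posRadii R ρ) :=
  isOpen_Ioi.inter (isOpen_Ioi.inter (isOpen_lt continuous_coe_real_ereal continuous_const))

lemma posRadii_subset_radii (R : ℝ) (ρ : EReal) : posRadii R ρ ⊆ radii R ρ :=
  fun _ h => ⟨h.1.le, h.2⟩

lemma mem_posRadii_of_le {R : ℝ} {ρ : EReal} {r s : ℝ} (hr : r ∈ posRadii R ρ) (h : r ≤ s)
    (hs : (s : EReal) < ρ) : s ∈ posRadii R ρ :=
  ⟨hr.1.trans_le h, hr.2.1.trans_le h, hs⟩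

lemma mk_zero_mem_annulus {R : ℝ} {ρ : EReal} {r : ℝ} (hr : r ∈ radii R ρ) :
    (r, (0 : ℝ)) ∈ annulus R ρ := by
  rw [annulus, Set.mem_ofPred_eq, radius_mk_zero hr.1]
  exact hr

variable {φ : ℝ → ℝ} {a : EReal} {R : ℝ} {ρ : EReal} {u : ℝ → ℝ}

lemma IsRotational.contDiffOn_radii (H : IsRotational φ a R ρ u) :
    ContDiffOn ℝ 2 u (radii R ρ) := by
  have h : ContDiffOn ℝ 2 ((fun p => u (radius p)) ∘ fun r : ℝ => (r, (0 : ℝ))) (radii R ρ) :=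
    H.contDiffOn.comp (by fun_prop) fun r hr => mk_zero_mem_annulus hr
  refine h.congr fun r hr => ?_
  simp [radius_mk_zero hr.1]

lemma IsRotational.isProfile (H : IsRotational φ a R ρ u) :
    IsProfile φ a (posRadii R ρ) u (deriv u) := by
  have hO := isOpen_posRadii R ρ
  have hu := H.contDiffOn_radii.mono (posRadii_subset_radii R ρ)
  have h1 : ∀ r ∈ posRadii R ρ, HasDerivAt u (deriv u r) r := fun r hr =>
    ((hu.contDiffAt (hO.mem_nhds hr)).differentiableAt (by simp)).hasDerivAt
  have h2 : ∀ r ∈ posRadii R ρ, HasDerivAt (deriv u) (deriv (deriv u) r) r := fun r hr =>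
    (((hu.deriv_of_isOpen hO (m := 1) (by norm_num [one_add_one_eq_two])).contDiffAt
      (hO.mem_nhds hr)).differentiableAt (by simp)).hasDerivAt
  refine ⟨fun r hr => ?_, h1, fun r hr => ?_⟩
  · have := H.mem_heights _ (mk_zero_mem_annulus (posRadii_subset_radii R ρ hr))
    rwa [radius_mk_zero hr.1.le] at this
  · have he := H.equation _ (mk_zero_mem_annulus (posRadii_subset_radii R ρ hr))
    have hr0 := radius_mk_zero hr.1.le
    have key := radial_equation_iff (v := u) (w := deriv u) (w' := deriv (deriv u) r)
      (p := (r, 0)) (by rw [hr0]; exact hr.1)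
      (by rw [hr0]; exact eventually_of_mem (hO.mem_nhds hr) h1) (by rw [hr0]; exact h2 r hr)
      (deriv φ (u (radius (r, 0))))
    have h3 := key.1 he
    rw [hr0] at h3
    exact h3 ▸ h2 r hr

/-- Bootstrap: the right-hand side of the equation is continuous, so `w` is `C¹` and `v` is `C²`. -/
lemma IsProfile.contDiffOn {I : Set ℝ} {v w : ℝ → ℝ} (H : IsProfile φ a I v w) (hI : IsOpen I)
    (hpos : ∀ r ∈ I, 0 < r) (hφ : ContDiffOn ℝ ∞ φ (heights a)) : ContDiffOn ℝ 2 v I := by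
  have hv : ContinuousOn v I := fun r hr => (H.deriv_profile r hr).continuousAt.continuousWithinAt
  have hw : ContinuousOn w I := fun r hr => (H.deriv_slope r hr).continuousAt.continuousWithinAt
  have hw1 : ContDiffOn ℝ 1 w I := by
    rw [← zero_add (1 : WithTop ℕ∞), contDiffOn_succ_iff_deriv_of_isOpen hI]
    refine ⟨fun r hr => (H.deriv_slope r hr).differentiableAt.differentiableWithinAt, by simp, ?_⟩
    rw [contDiffOn_zero]
    have hc : ContinuousOn (fun r => (1 + w r ^ 2) * (deriv φ (v r) - w r / r)) I :=
      (continuousOn_const.add (hw.pow 2)).mul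
        (((contDiffOn_deriv hφ).continuousOn.comp hv H.mem_heights).sub
          (hw.div continuousOn_id fun r hr => (hpos r hr).ne'))
    exact hc.congr fun r hr => (H.deriv_slope r hr).deriv
  rw [← one_add_one_eq_two, contDiffOn_succ_iff_deriv_of_isOpen hI]
  exact ⟨fun r hr => (H.deriv_profile r hr).differentiableAt.differentiableWithinAt, by simp,
    hw1.congr fun r hr => (H.deriv_profile r hr).deriv⟩

/-- An extension of the profile gives an extension of the rotational graph. -/
lemma IsRotational.extend (H : IsRotational φ a R ρ u) (hρ : 0 < ρ)
    (hφ : ContDiffOn ℝ ∞ φ (heights a)) {ρ' : EReal} {v w : ℝ → ℝ}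
    (hv : IsProfile φ a (posRadii R ρ') v w) (heq : Set.EqOn v u (radii R ρ)) :
    IsRotational φ a R ρ' v := by
  -- On the open old annulus nothing changes locally. As `ρ > 0`, the origin can only lie there, so
  -- the remaining points have positive radius and the profile equation applies.
  have hloc : ∀ p ∈ annulus R ρ,
      (fun p => v (radius p)) =ᶠ[𝓝 p] fun p => u (radius p) := fun p hp =>
    eventually_of_mem ((isOpen_annulus R ρ).mem_nhds hp) fun q hq => heq hq
  have hfar : ∀ p ∈ annulus R ρ', p ∉ annulus R ρ → radius p ∈ posRadii R ρ' := by
    intro p hp hp'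
    refine ⟨?_, hp.2⟩
    rcases (radius_nonneg p).lt_or_eq with h | h
    · exact h
    · refine absurd ⟨hp.1, hp.2.1, ?_⟩ hp'
      rw [← h]
      exact_mod_cast hρ
  refine ⟨fun p hp => ?_, fun p hp => ?_, fun p hp => ?_⟩
  · by_cases hp' : p ∈ annulus R ρ
    · exact ((H.contDiffOn.contDiffAt ((isOpen_annulus R ρ).mem_nhds hp')).congr_of_eventuallyEq
        (hloc p hp')).contDiffWithinAt
    · have h := hfar p hp hp'
      have h1 := (hv.contDiffOn (isOpen_posRadii R ρ') (fun r hr => hr.1) hφ).contDiffAt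
        ((isOpen_posRadii R ρ').mem_nhds h)
      exact (h1.comp p (contDiffAt_radius h.1)).contDiffWithinAt
  · by_cases hp' : p ∈ annulus R ρ
    · have := H.mem_heights p hp'
      rwa [← heq hp'] at this
    · exact hv.mem_heights _ (hfar p hp hp')
  · by_cases hp' : p ∈ annulus R ρ
    · have h := hloc p hp'
      have he := H.equation p hp'
      rw [partialX_congr h, partialY_congr h, partialX_congr (eventuallyEq_partialX h),
        partialY_congr (eventuallyEq_partialY h), partialY_congr (eventuallyEq_partialX h),
        heq hp']
      exact he
    · have h := hfar p hp hp'
      exact (radial_equation_iff h.1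
        (eventually_of_mem ((isOpen_posRadii R ρ').mem_nhds h) hv.deriv_profile)
        (hv.deriv_slope _ h) _).2 rfl

/-! ### Continuation of nondecreasing profiles -/

/-- The expansion controls large `z`; monotonicity of `φ̇` controls the bounded range in between.
This feeds Gronwall's inequality. -/
lemma HasExpansionAtTop.exists_le_mul_add {a : EReal} {φ : ℝ → ℝ}
    (hφ : ContDiffOn ℝ ∞ φ (heights a)) (hφ₂ : ∀ z ∈ heights a, 0 ≤ deriv (deriv φ) z)
    {Λ β : ℝ} (hexp : HasExpansionAtTop (deriv φ) Λ β) {z₀ : ℝ} (hz₀ : z₀ ∈ heights a) :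
    ∃ A ≥ 0, ∃ B ≥ 0, ∀ z ≥ z₀, deriv φ z ≤ A * (z - z₀) + B := by
  obtain ⟨A, hA, hA0, -⟩ := hexp.exists_abs_sub_le
  obtain ⟨z₁, h₁⟩ := eventually_atTop.1 (hA0.and (eventually_ge_atTop 1))
  refine ⟨|Λ|, abs_nonneg _, |Λ * z₀ + β| + A + |deriv φ (max z₀ z₁)|, by positivity, ?_⟩
  intro z hz
  have h0 := abs_nonneg (Λ * z₀ + β)
  have h0' := abs_nonneg (deriv φ (max z₀ z₁))
  rcases le_total z₁ z with h | h
  · have h2 := (abs_le.1 (h₁ z h).1).2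
    have h3 : A / z ≤ A := div_le_self hA.le (h₁ z h).2
    have h4 : Λ * (z - z₀) ≤ |Λ| * (z - z₀) :=
      mul_le_mul_of_nonneg_right (le_abs_self _) (by linarith)
    have h5 := le_abs_self (Λ * z₀ + β)
    linarith
  · have hmem : ∀ y ≥ z₀, y ∈ heights a := fun y hy =>
      lt_of_lt_of_le (a := a) hz₀ (EReal.coe_le_coe_iff.2 hy)
    have h2 := monotoneOn_deriv hφ hφ₂ (hmem z hz) (hmem _ (le_max_left z₀ z₁))
      (h.trans (le_max_right _ _))
    have h3 := le_abs_self (deriv φ (max z₀ z₁))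
    have h4 : 0 ≤ |Λ| * (z - z₀) := mul_nonneg (abs_nonneg _) (by linarith)
    linarith

/-- Two functions with matching values and derivatives can be glued differentiably. -/
lemma hasDerivAt_ite_lt {f f' g : ℝ → ℝ} {ξ ρ L e : ℝ} (hξ : ξ < ρ)
    (hf : ∀ r ∈ Set.Ioo ξ ρ, HasDerivAt f (f' r) r) (hL : Tendsto f (𝓝[<] ρ) (𝓝 L))
    (he : Tendsto f' (𝓝[<] ρ) (𝓝 e)) (hg : HasDerivAt g e ρ) (hgL : g ρ = L) :
    HasDerivAt (fun r => if r < ρ then f r else g r) e ρ := by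
  set k : ℝ → ℝ := fun r => if r < ρ then f r else g r with hk
  have hkf : Set.EqOn k f (Set.Iio ρ) := fun r hr => if_pos hr
  have hkd : ∀ r ∈ Set.Ioo ξ ρ, HasDerivAt k (f' r) r := fun r hr =>
    (hf r hr).congr_of_eventuallyEq (eventually_of_mem (Iio_mem_nhds hr.2) hkf)
  have hleft : HasDerivWithinAt k e (Set.Iic ρ) ρ := by
    refine hasDerivWithinAt_Iic_of_tendsto_deriv (s := Set.Ioo ξ ρ)
      (fun r hr => (hkd r hr).differentiableAt.differentiableWithinAt) ?_
      (Ioo_mem_nhdsLT hξ) ?_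
    · have h1 : k ρ = L := by simp [hk, hgL]
      rw [ContinuousWithinAt, h1]
      refine (hL.mono_left (nhdsWithin_mono _ fun r hr => hr.2)).congr' ?_
      exact eventually_of_mem self_mem_nhdsWithin fun r hr => (hkf hr.2).symm
    · exact he.congr' (eventually_of_mem (Ioo_mem_nhdsLT hξ) fun r hr => (hkd r hr).deriv.symm)
  have hright : HasDerivWithinAt k e (Set.Ici ρ) ρ := by
    refine hg.hasDerivWithinAt.congr (fun r hr => if_neg (not_lt.2 hr)) (if_neg (lt_irrefl _))
  have := hleft.union hright
  rwa [Set.Iic_union_Ici, hasDerivWithinAt_univ] at this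

/-- Local existence for the profile equation. -/
lemma exists_local_profile {a : EReal} {φ : ℝ → ℝ} (hφ : ContDiffOn ℝ ∞ φ (heights a))
    {ρ L W : ℝ} (hρ : 0 < ρ) (hL : L ∈ heights a) :
    ∃ ε > 0, ∃ y p : ℝ → ℝ, y ρ = L ∧ p ρ = W ∧
      IsProfile φ a (Set.Ioo (ρ - ε) (ρ + ε)) y p := by
  -- The equation is made autonomous by carrying `r` as a first coordinate of speed `1`; `htime`
  -- identifies that coordinate with the time.
  set f : ℝ × ℝ × ℝ → ℝ × ℝ × ℝ :=
    fun x => (1, x.2.2, (1 + x.2.2 ^ 2) * (deriv φ x.2.1 - x.2.2 / x.1)) with hf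
  have hf1 : ContDiffAt ℝ 1 f (ρ, L, W) := by
    have h1 : ContDiffAt ℝ 1 (fun x : ℝ × ℝ × ℝ => deriv φ x.2.1) (ρ, L, W) := by
      have h2 : ContDiffAt ℝ 1 (deriv φ) L :=
        (((contDiffOn_deriv hφ).contDiffAt ((isOpen_heights a).mem_nhds hL))).of_le
          (by exact_mod_cast le_top)
      exact ContDiffAt.comp (g := deriv φ) (f := fun x : ℝ × ℝ × ℝ => x.2.1) (ρ, L, W) h2
        (by fun_prop)
    have h3 : ContDiffAt ℝ 1 (fun x : ℝ × ℝ × ℝ => x.2.2 / x.1) (ρ, L, W) :=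
      ContDiffAt.div (by fun_prop) (by fun_prop) hρ.ne'
    exact contDiffAt_const.prodMk (ContDiffAt.prodMk (by fun_prop)
      (ContDiffAt.mul (by fun_prop) (h1.sub h3)))
  obtain ⟨α, hα0, ε, hε, hα⟩ :=
    hf1.exists_forall_mem_closedBall_exists_eq_forall_mem_Ioo_hasDerivAt₀ ρ
  have d1 : ∀ t ∈ Set.Ioo (ρ - ε) (ρ + ε), HasDerivAt (fun t => (α t).1) 1 t := fun t ht =>
    (hα t ht).fst
  have d2 : ∀ t ∈ Set.Ioo (ρ - ε) (ρ + ε), HasDerivAt (fun t => (α t).2.1) (α t).2.2 t :=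
    fun t ht => (hα t ht).snd.fst
  have d3 : ∀ t ∈ Set.Ioo (ρ - ε) (ρ + ε), HasDerivAt (fun t => (α t).2.2)
      ((1 + (α t).2.2 ^ 2) * (deriv φ (α t).2.1 - (α t).2.2 / (α t).1)) t :=
    fun t ht => (hα t ht).snd.snd
  have hρmem : ρ ∈ Set.Ioo (ρ - ε) (ρ + ε) := ⟨by linarith, by linarith⟩
  have htime : Set.EqOn (fun t => (α t).1) id (Set.Ioo (ρ - ε) (ρ + ε)) := by
    refine isOpen_Ioo.eqOn_of_deriv_eq isPreconnected_Ioo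
      (fun t ht => (d1 t ht).differentiableAt.differentiableWithinAt)
      differentiableOn_id (fun t ht => ?_) hρmem (by simp [hα0])
    rw [(d1 t ht).deriv, deriv_id]
  have hmem : ∀ᶠ t in 𝓝 ρ, (α t).2.1 ∈ heights a := by
    refine (d2 ρ hρmem).continuousAt.eventually ?_
    simp only [hα0]
    exact (isOpen_heights a).mem_nhds hL
  obtain ⟨δ, hδ, hδ'⟩ := Metric.eventually_nhds_iff_ball.1 hmem
  rw [Real.ball_eq_Ioo] at hδ'
  have hsub : Set.Ioo (ρ - min ε δ) (ρ + min ε δ) ⊆ Set.Ioo (ρ - ε) (ρ + ε) :=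
    Set.Ioo_subset_Ioo (by linarith [min_le_left ε δ]) (by linarith [min_le_left ε δ])
  refine ⟨min ε δ, lt_min hε hδ, fun t => (α t).2.1, fun t => (α t).2.2, by simp [hα0],
    by simp [hα0], ⟨fun t ht => hδ' t ?_, fun t ht => d2 t (hsub ht), fun t ht => ?_⟩⟩
  · exact Set.Ioo_subset_Ioo (by linarith [min_le_right ε δ]) (by linarith [min_le_right ε δ]) ht
  · have := d3 t (hsub ht)
    rwa [show (α t).1 = t from htime (hsub ht)] at this

namespace IsProfile

variable {a : EReal} {φ : ℝ → ℝ} {u w : ℝ → ℝ}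

lemma slope_nonneg_of_le {I : Set ℝ} (H : IsProfile φ a I u w)
    (hφ₁ : ∀ z ∈ heights a, 0 < deriv φ z) {ξ r : ℝ} (hI : Set.Icc ξ r ⊆ I) (hr : ξ ≤ r)
    (hξ : 0 ≤ w ξ) : 0 ≤ w r := by
  have key := image_le_of_deriv_right_lt_deriv_boundary' (f := fun r => -w r)
    (f' := fun r => -((1 + w r ^ 2) * (deriv φ (u r) - w r / r))) (a := ξ) (b := r)
    (B := fun _ => 0) (B' := fun _ => 0)
    (fun x hx => (H.deriv_slope x (hI hx)).neg.continuousAt.continuousWithinAt)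
    (fun x hx => (H.deriv_slope x (hI (Set.Ico_subset_Icc_self hx))).neg.hasDerivWithinAt)
    (by simpa using hξ) continuousOn_const (fun x _ => hasDerivWithinAt_const _ _ _)
    (fun x hx h0 => by
      have h1 : w x = 0 := by simpa using h0
      have h2 := hφ₁ _ (H.mem_heights x (hI (Set.Ico_subset_Icc_self hx)))
      simp only [h1]
      simpa using h2)
  simpa using key ⟨hr, le_rfl⟩

section Bounded

variable {ξ ρ : ℝ} (H : IsProfile φ a (Set.Ico ξ ρ) u w) (hξ : 0 < ξ)
  (hw : ∀ r ∈ Set.Ico ξ ρ, 0 ≤ w r) (hφ : ContDiffOn ℝ ∞ φ (heights a))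
  (hφ₁ : ∀ z ∈ heights a, 0 < deriv φ z) (hφ₂ : ∀ z ∈ heights a, 0 ≤ deriv (deriv φ) z)
include H hξ hw hφ hφ₁ hφ₂

/-- At a point of equality `w / r ≥ φ̇(u)`, so `w' ≤ 0`, while the right-hand side has derivative at
least `φ̇(u) > 0`. -/
lemma slope_le : ∀ r ∈ Set.Ico ξ ρ, w r ≤ w ξ + r * deriv φ (u r) := by
  intro r hr
  have hsub : Set.Icc ξ r ⊆ Set.Ico ξ ρ := fun x hx => ⟨hx.1, hx.2.trans_lt hr.2⟩
  have hd : ∀ x ∈ Set.Icc ξ r, HasDerivAt (fun r => w r - w ξ - r * deriv φ (u r))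
      ((1 + w x ^ 2) * (deriv φ (u x) - w x / x)
        - (1 * deriv φ (u x) + x * (deriv (deriv φ) (u x) * w x))) x := fun x hx =>
    ((H.deriv_slope x (hsub hx)).sub_const _).sub ((hasDerivAt_id x).mul
      ((hasDerivAt_deriv_of_mem_heights hφ (H.mem_heights x (hsub hx))).comp x
        (H.deriv_profile x (hsub hx))))
  have key := image_le_of_deriv_right_lt_deriv_boundary' (a := ξ) (b := r)
    (B := fun _ => 0) (B' := fun _ => 0)
    (fun x hx => (hd x hx).continuousAt.continuousWithinAt)
    (fun x hx => (hd x (Set.Ico_subset_Icc_self hx)).hasDerivWithinAt)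
    (by
      have := hφ₁ _ (H.mem_heights ξ (hsub ⟨le_rfl, hr.1⟩))
      have : 0 < ξ * deriv φ (u ξ) := mul_pos hξ this
      linarith)
    continuousOn_const (fun x _ => hasDerivWithinAt_const _ _ _)
    (fun x hx h0 => by
      have hx' := hsub (Set.Ico_subset_Icc_self hx)
      have hx0 : 0 < x := hξ.trans_le hx.1
      have h1 := hφ₁ _ (H.mem_heights x hx')
      have h2 := hφ₂ _ (H.mem_heights x hx')
      have h3 := hw x hx'
      have h4 : 0 ≤ w ξ := hw ξ (hsub ⟨le_rfl, hr.1⟩)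
      have h5 : deriv φ (u x) ≤ w x / x := by
        rw [le_div_iff₀ hx0]
        linarith
      have h6 : (1 + w x ^ 2) * (deriv φ (u x) - w x / x) ≤ 0 :=
        mul_nonpos_of_nonneg_of_nonpos (by positivity) (by linarith)
      have h7 : 0 ≤ x * (deriv (deriv φ) (u x) * w x) := by positivity
      linarith)
  have := key ⟨hr.1, le_rfl⟩
  linarith

/-- `slope_le` and linear growth of `φ̇` make `u' = w` at most affine in `u - u ξ`; Gronwall bounds
`u`, and then `w`. -/
lemma exists_bound {Λ β : ℝ} (hexp : HasExpansionAtTop (deriv φ) Λ β) (hξρ : ξ < ρ) :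
    ∃ M, ∀ r ∈ Set.Ico ξ ρ, u r ≤ M ∧ w r ≤ M := by
  have hξmem : ξ ∈ Set.Ico ξ ρ := ⟨le_rfl, hξρ⟩
  obtain ⟨A, hA, B, hB, hAB⟩ := hexp.exists_le_mul_add hφ hφ₂ (H.mem_heights ξ hξmem)
  have hmono := H.monotoneOn Set.ordConnected_Ico hw
  have hwξ := hw ξ hξmem
  have hρ : 0 < ρ := hξ.trans hξρ
  have hslope : ∀ r ∈ Set.Ico ξ ρ, w r ≤ ρ * A * (u r - u ξ) + (w ξ + ρ * B) := by
    intro r hr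
    have h1 := H.slope_le hξ hw hφ hφ₁ hφ₂ r hr
    have h2 := hmono hξmem hr hr.1
    have h3 := hAB (u r) h2
    have h4 : r * deriv φ (u r) ≤ ρ * (A * (u r - u ξ) + B) :=
      mul_le_mul hr.2.le h3 (hφ₁ _ (H.mem_heights r hr)).le hρ.le
    linarith
  set N := gronwallBound 0 (ρ * A) (w ξ + ρ * B) (ρ - ξ) with hN
  have hu : ∀ r ∈ Set.Ico ξ ρ, u r - u ξ ≤ N := by
    intro r hr
    have hsub : Set.Icc ξ r ⊆ Set.Ico ξ ρ := fun x hx => ⟨hx.1, hx.2.trans_lt hr.2⟩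
    have h1 := norm_le_gronwallBound_of_norm_deriv_right_le (f := fun r => u r - u ξ) (f' := w)
      (δ := 0) (K := ρ * A) (ε := w ξ + ρ * B) (a := ξ) (b := r)
      (fun x hx => ((H.deriv_profile x (hsub hx)).sub_const _).continuousAt.continuousWithinAt)
      (fun x hx => ((H.deriv_profile x (hsub (Set.Ico_subset_Icc_self hx))).sub_const _
        ).hasDerivWithinAt)
      (by simp)
      (fun x hx => by
        have hx' := hsub (Set.Ico_subset_Icc_self hx)
        rw [Real.norm_of_nonneg (hw x hx'),
          Real.norm_of_nonneg (sub_nonneg.2 (hmono hξmem hx' hx'.1))]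
        exact hslope x hx') r ⟨hr.1, le_rfl⟩
    refine (le_abs_self _).trans (h1.trans ?_)
    exact gronwallBound_mono le_rfl (by positivity) (by positivity) (by linarith [hr.2])
  refine ⟨max (u ξ + N) (ρ * A * N + (w ξ + ρ * B)), fun r hr => ⟨?_, ?_⟩⟩
  · exact le_max_of_le_left (by linarith [hu r hr])
  · refine le_max_of_le_right ((hslope r hr).trans ?_)
    have := hu r hr
    gcongr

lemma exists_tendsto {Λ β : ℝ} (hexp : HasExpansionAtTop (deriv φ) Λ β) (hξρ : ξ < ρ) :
    ∃ L W, L ∈ heights a ∧ Tendsto u (𝓝[<] ρ) (𝓝 L) ∧ Tendsto w (𝓝[<] ρ) (𝓝 W) := by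
  obtain ⟨M, hM⟩ := H.exists_bound hξ hw hφ hφ₁ hφ₂ hexp hξρ
  have hne : (Set.Ioo ξ ρ).Nonempty := Set.nonempty_Ioo.2 hξρ
  have hsub : Set.Ioo ξ ρ ⊆ Set.Ico ξ ρ := Set.Ioo_subset_Ico_self
  have hmono := H.monotoneOn Set.ordConnected_Ico hw
  have hu := (hmono.mono hsub).tendsto_nhdsWithin_Ioo_left hne (by
    refine ⟨M, ?_⟩
    rintro _ ⟨r, hr, rfl⟩
    exact (hM r (hsub hr)).1)
  have hM0 : 0 ≤ M := (hw ξ ⟨le_rfl, hξρ⟩).trans (hM ξ ⟨le_rfl, hξρ⟩).2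
  -- A lower bound `w' ≥ -N`, by dropping the positive term in `φ̇`; hence `w + N r` is monotone and
  -- bounded.
  set N := (1 + M ^ 2) * (M / ξ) with hN
  have hwmono : MonotoneOn (fun r => w r + N * r) (Set.Ioo ξ ρ) := by
    refine monotoneOn_of_hasDerivWithinAt_nonneg
      (f' := fun r => (1 + w r ^ 2) * (deriv φ (u r) - w r / r) + N * 1) (convex_Ioo _ _) ?_ ?_ ?_
    · intro r hr
      exact ((H.deriv_slope r (hsub hr)).add
        ((hasDerivAt_id r).const_mul N)).continuousAt.continuousWithinAt
    · intro r hr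
      rw [interior_Ioo] at hr
      exact ((H.deriv_slope r (hsub hr)).add ((hasDerivAt_id r).const_mul N)).hasDerivWithinAt
    · intro r hr
      rw [interior_Ioo] at hr
      have h1 := hφ₁ _ (H.mem_heights r (hsub hr))
      have h2 := hw r (hsub hr)
      have h3 := (hM r (hsub hr)).2
      have hr0 : 0 < r := hξ.trans hr.1
      have h4 : w r / r ≤ M / ξ := div_le_div₀ hM0 h3 hξ hr.1.le
      have h5 : (1 + w r ^ 2) * (w r / r) ≤ N := by
        rw [hN]
        gcongr
      have h6 : 0 ≤ (1 + w r ^ 2) * deriv φ (u r) := by positivity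
      rw [mul_sub]
      linarith
  have hw' := hwmono.tendsto_nhdsWithin_Ioo_left hne (by
    refine ⟨M + N * ρ, ?_⟩
    rintro _ ⟨r, hr, rfl⟩
    have h1 := (hM r (hsub hr)).2
    have h2 : N * r ≤ N * ρ := mul_le_mul_of_nonneg_left hr.2.le (by positivity)
    simp only
    linarith)
  have hid : Tendsto (fun r : ℝ => N * r) (𝓝[<] ρ) (𝓝 (N * ρ)) :=
    ((continuous_const_mul N).tendsto ρ).mono_left nhdsWithin_le_nhds
  refine ⟨_, _, ?_, hu, (hw'.sub hid).congr fun r => by ring⟩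
  refine lt_of_lt_of_le (a := a) (H.mem_heights ξ ⟨le_rfl, hξρ⟩) (EReal.coe_le_coe_iff.2 ?_)
  refine ge_of_tendsto hu (eventually_of_mem (Ioo_mem_nhdsLT hξρ) fun r hr => ?_)
  exact hmono ⟨le_rfl, hξρ⟩ (hsub hr) hr.1.le

end Bounded

/-- A profile that is somewhere nondecreasing extends beyond any finite radius. -/
theorem exists_extension {R ρ ξ : ℝ} (H : IsProfile φ a (posRadii R ρ) u w)
    (hξ : ξ ∈ posRadii R ρ) (hwξ : 0 ≤ w ξ) (hφ : ContDiffOn ℝ ∞ φ (heights a))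
    (hφ₁ : ∀ z ∈ heights a, 0 < deriv φ z) (hφ₂ : ∀ z ∈ heights a, 0 ≤ deriv (deriv φ) z)
    {Λ β : ℝ} (hexp : HasExpansionAtTop (deriv φ) Λ β) :
    ∃ ρ' > ρ, ∃ v w' : ℝ → ℝ, IsProfile φ a (posRadii R ρ') v w' ∧
      ∀ r < ρ, v r = u r := by
  have hξρ : ξ < ρ := EReal.coe_lt_coe_iff.1 hξ.2.2
  have hρ : 0 < ρ := hξ.1.trans hξρ
  have hsub : Set.Ico ξ ρ ⊆ posRadii R ρ := fun r hr =>
    mem_posRadii_of_le hξ hr.1 (EReal.coe_lt_coe_iff.2 hr.2)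
  have H' : IsProfile φ a (Set.Ico ξ ρ) u w :=
    ⟨fun r hr => H.mem_heights r (hsub hr), fun r hr => H.deriv_profile r (hsub hr),
      fun r hr => H.deriv_slope r (hsub hr)⟩
  have hw : ∀ r ∈ Set.Ico ξ ρ, 0 ≤ w r := fun r hr =>
    H'.slope_nonneg_of_le hφ₁ (fun x hx => ⟨hx.1, hx.2.trans_lt hr.2⟩) hr.1 hwξ
  obtain ⟨L, W, hL, huL, hwW⟩ := H'.exists_tendsto hξ.1 hw hφ hφ₁ hφ₂ hexp hξρ
  obtain ⟨ε, hε, y, p, hy, hp, hyp⟩ := exists_local_profile (W := W) hφ hρ hL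
  have hρmem : ρ ∈ Set.Ioo (ρ - ε) (ρ + ε) := ⟨by linarith, by linarith⟩
  -- The limit of `w'` from the left equals the derivative at `ρ` of the restarted slope, so the
  -- glued slope is differentiable at `ρ`.
  have hder : Tendsto (fun r => (1 + w r ^ 2) * (deriv φ (u r) - w r / r)) (𝓝[<] ρ)
      (𝓝 ((1 + W ^ 2) * (deriv φ L - W / ρ))) := by
    have h1 : Tendsto (fun r => deriv φ (u r)) (𝓝[<] ρ) (𝓝 (deriv φ L)) :=
      (hasDerivAt_deriv_of_mem_heights hφ hL).continuousAt.tendsto.comp huL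
    have h2 : Tendsto (fun r : ℝ => r) (𝓝[<] ρ) (𝓝 ρ) := nhdsWithin_le_nhds
    exact ((hwW.pow 2).const_add 1).mul (h1.sub (hwW.div h2 hρ.ne'))
  refine ⟨ρ + ε, by linarith, fun r => if r < ρ then u r else y r,
    fun r => if r < ρ then w r else p r, ?_, fun r hr => if_pos hr⟩
  have hcases : ∀ r ∈ posRadii R ((ρ + ε : ℝ) : EReal), (r < ρ ∧ r ∈ posRadii R ρ) ∨ r = ρ ∨
      (ρ < r ∧ r ∈ Set.Ioo (ρ - ε) (ρ + ε)) := by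
    intro r hr
    have h1 : r < ρ + ε := EReal.coe_lt_coe_iff.1 hr.2.2
    rcases lt_trichotomy r ρ with h | h | h
    · exact Or.inl ⟨h, hr.1, hr.2.1, EReal.coe_lt_coe_iff.2 h⟩
    · exact Or.inr (Or.inl h)
    · exact Or.inr (Or.inr ⟨h, by linarith, h1⟩)
  have hlt : ∀ {f g : ℝ → ℝ} {r : ℝ}, r < ρ →
      (fun r => if r < ρ then f r else g r) =ᶠ[𝓝 r] f := fun h =>
    eventually_of_mem (Iio_mem_nhds h) fun s hs => if_pos hs
  have hgt : ∀ {f g : ℝ → ℝ} {r : ℝ}, ρ < r →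
      (fun r => if r < ρ then f r else g r) =ᶠ[𝓝 r] g := fun h =>
    eventually_of_mem (Ioi_mem_nhds h) fun s hs => if_neg (not_lt.2 (le_of_lt hs))
  have hIoo : Set.Ioo ξ ρ ⊆ Set.Ico ξ ρ := Set.Ioo_subset_Ico_self
  refine ⟨fun r hr => ?_, fun r hr => ?_, fun r hr => ?_⟩
  · rcases hcases r hr with ⟨h, h'⟩ | rfl | ⟨h, h'⟩
    · simpa only [if_pos h] using H.mem_heights r h'
    · simpa only [lt_irrefl, if_false, hy] using hL
    · simpa only [if_neg h.not_gt] using hyp.mem_heights r h'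
  · rcases hcases r hr with ⟨h, h'⟩ | rfl | ⟨h, h'⟩
    · rw [if_pos h]
      exact (H.deriv_profile r h').congr_of_eventuallyEq (hlt h)
    · rw [if_neg (lt_irrefl _), hp]
      exact hasDerivAt_ite_lt hξρ (fun s hs => H'.deriv_profile s (hIoo hs)) huL hwW
        (hp ▸ hyp.deriv_profile r hρmem) hy
    · rw [if_neg h.not_gt]
      exact (hyp.deriv_profile r h').congr_of_eventuallyEq (hgt h)
  · rcases hcases r hr with ⟨h, h'⟩ | rfl | ⟨h, h'⟩
    · rw [if_pos h, if_pos h]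
      exact (H.deriv_slope r h').congr_of_eventuallyEq (hlt h)
    · rw [if_neg (lt_irrefl _), if_neg (lt_irrefl _), hp, hy]
      exact hasDerivAt_ite_lt hξρ (fun s hs => H'.deriv_slope s (hIoo hs)) hwW hder
        (by simpa only [hp, hy] using hyp.deriv_slope r hρmem) hp
    · rw [if_neg h.not_gt, if_neg h.not_gt]
      exact (hyp.deriv_slope r h').congr_of_eventuallyEq (hgt h)

end IsProfile

/-- A rotational graph that is not strictly decreasing has a radius with nonnegative slope. -/
lemma IsRotational.exists_deriv_nonneg {φ : ℝ → ℝ} {a : EReal} {R : ℝ} {ρ : EReal} {u : ℝ → ℝ}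
    (H : IsRotational φ a R ρ u) (hmono : ¬ StrictAntiOn u (radii R ρ)) :
    ∃ ξ ∈ posRadii R ρ, 0 ≤ deriv u ξ := by
  by_contra! hneg
  refine hmono ?_
  have hconv : Convex ℝ (radii R ρ) := by
    refine Set.OrdConnected.convex ⟨fun x hx y hy z hz => ⟨hx.1.trans hz.1,
      hx.2.1.trans_le hz.1, lt_of_le_of_lt (EReal.coe_le_coe_iff.2 hz.2) hy.2.2⟩⟩
  refine strictAntiOn_of_deriv_neg hconv H.contDiffOn_radii.continuousOn fun r hr => hneg r ?_
  have h1 := interior_subset hr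
  refine ⟨?_, h1.2⟩
  -- Interior points of `radii R ρ` are nonzero, so the origin of a disc needs only continuity.
  have h2 : r ∈ interior (Set.Ici (0 : ℝ)) := interior_mono (fun x hx => hx.1) hr
  rwa [interior_Ici] at h2

end PhiMinimal

end

/-! ### The main theorem -/

theorem mainTheorem7 (a : EReal) (ha : a ≠ ⊤) (φ : ℝ → ℝ) (Λ β : ℝ)
    (hφ : ContDiffOn ℝ ∞ φ (PhiMinimal.heights a))
    (hφ₁ : ∀ z ∈ PhiMinimal.heights a, 0 < deriv φ z)
    (hφ₂ : ∀ z ∈ PhiMinimal.heights a, 0 ≤ deriv (deriv φ) z)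
    (hexp : PhiMinimal.HasExpansionAtTop (deriv φ) Λ β)
    (R : ℝ) (ρ : EReal) (u : ℝ → ℝ)
    (hu : PhiMinimal.IsMaximalRotational φ a R ρ u)
    (hmono : ¬ StrictAntiOn u (PhiMinimal.radii R ρ)) :
    ρ = ⊤ ∧
    (0 < Λ → ∃ C : ℝ, 0 < C ∧
      (fun r : ℝ => φ (u r) - C * Real.exp (Λ * r ^ 2)) =O[atTop] (fun r : ℝ => r ^ 2)) ∧
    (Λ = 0 → ∀ u₀ ∈ PhiMinimal.heights a, ∃ c : ℝ,
      (fun r : ℝ => (∫ ξ in u₀..u r, 1 / deriv φ ξ)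
          - (r ^ 2 / 2 - 1 / β ^ 2 * Real.log r + c)) =O[atTop] (fun r : ℝ => (r ^ 2)⁻¹)) := by
  obtain ⟨hrot, hmax⟩ := hu
  obtain ⟨ξ, hξ, hwξ⟩ := hrot.exists_deriv_nonneg hmono
  have H := hrot.isProfile
  have hρ : ρ = ⊤ := by
    induction ρ with
    | top => rfl
    | bot => exact absurd hξ.2.2 not_lt_bot
    | coe ρ =>
      obtain ⟨ρ', hρ', v, w', hv, hvu⟩ := H.exists_extension hξ hwξ hφ hφ₁ hφ₂ hexp
      have heq : Set.EqOn v u (PhiMinimal.radii R ρ) := fun r hr =>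
        hvu r (EReal.coe_lt_coe_iff.1 hr.2.2)
      have hpos : (0 : EReal) < ρ :=
        lt_trans (by exact_mod_cast hξ.1 : (0 : EReal) < (ξ : EReal)) hξ.2.2
      exact absurd ⟨ρ', v, EReal.coe_lt_coe_iff.2 hρ', hrot.extend hpos hφ hv heq, heq⟩ hmax
  subst hρ
  have hsub : ∀ r, ξ ≤ r → r ∈ PhiMinimal.posRadii R ⊤ := fun r hr =>
    PhiMinimal.mem_posRadii_of_le hξ hr (EReal.coe_lt_top r)
  have H' : PhiMinimal.IsProfile φ a (Set.Ioi ξ) u (deriv u) :=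
    ⟨fun r hr => H.mem_heights r (hsub r (le_of_lt hr)),
      fun r hr => H.deriv_profile r (hsub r (le_of_lt hr)),
      fun r hr => H.deriv_slope r (hsub r (le_of_lt hr))⟩
  have hw : ∀ r ∈ Set.Ioi ξ, 0 ≤ deriv u r := fun r hr =>
    H.slope_nonneg_of_le hφ₁ (fun x hx => hsub x hx.1) (le_of_lt hr) hwξ
  refine ⟨rfl, fun hΛ => H'.asymptotics_of_pos hw ha hφ hφ₁ hφ₂ hexp hΛ, ?_⟩
  rintro rfl u₀ hu₀
  exact H'.asymptotics_of_eq_zero hw hφ hφ₁ hφ₂ hexp hu₀
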